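/- Let $\mathbb{D}$ be the open unit disc of $\mathbb{C}$ and $dA=\frac{dx\,dy}{\pi}$. Let $v:\mathbb{D}\to(0,\infty)$ be a radial weight, that is, $v$ is integrable over $\mathbb{D}$ and $v(z)=v(|z|)$ for all $z\in\mathbb{D}$. Put $\widehat{v}(r)=\int_r^1 v(s)\,ds$ and suppose that $v\in\widehat{\mathcal{D}}$, i.e. $$\sup_{0<r<1}\frac{\widehat{v}(r)}{\widehat{v}\left(\frac{1+r}{2}\right)}<\infty .$$ Let $\mathcal{D}_v$ be the space of all analytic functions $f$ in $\mathbb{D}$ with $$\|f\|_{\mathcal{D}_v}^2=|f(0)|^2+\int_{\mathbb{D}}|f'(z)|^2v(z)\,dA(z)<\infty .$$ Suppose that $$M_1(v)=\sup_{0<r<1}\left(\int_r^1\frac{\widehat{v}(s)}{(1-s)^2}\,ds\right)^{1/2}\left(\int_0^r\frac{1}{\widehat{v}(s)}\,ds\right)^{1/2}<\infty$$ and $$M_2(v)=\sup_{0<r<1}\left(\int_0^r\frac{\widehat{v}(s)}{(1-s)^4}\,ds\right)^{1/2}\left(\int_r^1\frac{(1-s)^2}{\widehat{v}(s)}\,ds\right)^{1/2}<\infty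 .$$ Then the Hilbert operator $$\mathcal{H}(f)(z)=\int_0^1 f(t)\,g'(tz)\,dt,\qquad g(z)=\log\frac{1}{1-z},$$ that is, $\mathcal{H}(f)(z)=\int_0^1\frac{f(t)}{1-tz}\,dt$, and the sublinear Hilbert operator $$\widetilde{\mathcal{H}}(f)(z)=\int_0^1\frac{|f(t)|}{1-tz}\,dt$$ are both well defined and bounded on $\mathcal{D}_v$: for every $f\in\mathcal{D}_v$ and $z\in\mathbb{D}$ the defining integrals converge absolutely, the functions $\mathcal{H}(f)$ and $\widetilde{\mathcal{H}}(f)$ belong to $\mathcal{D}_v$, and there is a constant $C<\infty$, independent of $f$, such that $$\|\mathcal{H}(f)\|_{\mathcal{D}_v}\le C\|f\|_{\mathcal{D}_v}\quad\text{and}\quad \|\widetilde{\mathcal{H}}(f)\|_{\mathcal{D}_v}\le C\|f\|_{\mathcal{D}_v}\qquad (f\in\mathcal{D}_v).$$ -/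

import Mathlib

open MeasureTheory Set

open scoped NNReal ENNReal

noncomputable section

/-- The open unit disc of the complex plane. -/
def unitDisc : Set ℂ := Metric.ball (0 : ℂ) 1

/-- The normalized Lebesgue area measure `dA = dx dy / π`. -/
def normalizedArea : Measure ℂ := (ENNReal.ofReal Real.pi)⁻¹ • (volume : Measure ℂ)

/-- `v` is a radial weight: positive and integrable on the unit disc, with `v z = v |z|` there.
Values outside the disc play no role. -/
structure IsRadialWeight (v : ℂ → ℝ) : Prop where
  pos : ∀ z ∈ unitDisc, 0 < v z
  integrable : IntegrableOn v unitDisc normalizedArea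
  radial : ∀ z ∈ unitDisc, v z = v ((‖z‖ : ℝ) : ℂ)

/-- The tail integral `∫_r^1 v(s) ds`, as a number in `[0, ∞]`. -/
def tailIntegral (v : ℂ → ℝ) (r : ℝ) : ℝ≥0∞ :=
  ∫⁻ s in Ioo r 1, ENNReal.ofReal (v (s : ℂ))

/-- The class of doubling weights: radial weights whose tail integral satisfies
`sup_{0<r<1} v̂(r) / v̂((1+r)/2) < ∞`. -/
structure IsDoublingWeight (v : ℂ → ℝ) : Prop where
  isRadialWeight : IsRadialWeight v
  doubling : (⨆ r ∈ Ioo (0 : ℝ) 1, tailIntegral v r / tailIntegral v ((1 + r) / 2)) < ∞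

/-- The first Muckenhoupt-type quantity
`sup_{0<r<1} (∫_r^1 v̂(s)/(1-s)^2 ds)^{1/2} (∫_0^r 1/v̂(s) ds)^{1/2}`. -/
def muckenhouptOne (v : ℂ → ℝ) : ℝ≥0∞ :=
  ⨆ r ∈ Ioo (0 : ℝ) 1,
    (∫⁻ s in Ioo r 1, tailIntegral v s / ENNReal.ofReal ((1 - s) ^ 2)) ^ (1 / 2 : ℝ) *
    (∫⁻ s in Ioo 0 r, 1 / tailIntegral v s) ^ (1 / 2 : ℝ)

/-- The second Muckenhoupt-type quantity
`sup_{0<r<1} (∫_0^r v̂(s)/(1-s)^4 ds)^{1/2} (∫_r^1 (1-s)^2/v̂(s) ds)^{1/2}`. -/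
def muckenhouptTwo (v : ℂ → ℝ) : ℝ≥0∞ :=
  ⨆ r ∈ Ioo (0 : ℝ) 1,
    (∫⁻ s in Ioo 0 r, tailIntegral v s / ENNReal.ofReal ((1 - s) ^ 4)) ^ (1 / 2 : ℝ) *
    (∫⁻ s in Ioo r 1, ENNReal.ofReal ((1 - s) ^ 2) / tailIntegral v s) ^ (1 / 2 : ℝ)

/-- The Dirichlet-type norm `(|f(0)|^2 + ∫_D |f'(z)|^2 v(z) dA(z))^{1/2}`, in `[0, ∞]`. -/
def dirichletNorm (v : ℂ → ℝ) (f : ℂ → ℂ) : ℝ≥0∞ :=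
  (ENNReal.ofReal (‖f 0‖ ^ 2) +
    ∫⁻ z in unitDisc, ENNReal.ofReal (‖deriv f z‖ ^ 2 * v z) ∂normalizedArea) ^ (1 / 2 : ℝ)

/-- The weighted Dirichlet space `D_v`: functions analytic in the unit disc with finite norm.
(A function on the disc is represented by any extension of it to `ℂ`.) -/
structure MemDirichlet (v : ℂ → ℝ) (f : ℂ → ℂ) : Prop where
  analytic : DifferentiableOn ℂ f unitDisc
  norm_lt_top : dirichletNorm v f < ∞

/-- The integrand `f(t) g'(tz)` of the generalized Hilbert operator. -/
def generalizedHilbertIntegrand (g f : ℂ → ℂ) (z : ℂ) (t : ℝ) : ℂ :=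
  f (t : ℂ) * deriv g ((t : ℂ) * z)

/-- The generalized Hilbert operator `H_g(f)(z) = ∫_0^1 f(t) g'(tz) dt`. -/
def generalizedHilbert (g f : ℂ → ℂ) (z : ℂ) : ℂ :=
  ∫ t in (0 : ℝ)..1, generalizedHilbertIntegrand g f z t

/-- The symbol `log (1/(1-z))` (principal branch). -/
def hilbertSymbol (z : ℂ) : ℂ := Complex.log (1 / (1 - z))

/-- The Hilbert operator `H`, i.e. `H_g` with `g(z) = log (1/(1-z))`. -/
def hilbertOperator : (ℂ → ℂ) → (ℂ → ℂ) := generalizedHilbert hilbertSymbol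

/-- The integrand `|f(t)| / (1-tz)` of the sublinear Hilbert operator. -/
def sublinearHilbertIntegrand (f : ℂ → ℂ) (z : ℂ) (t : ℝ) : ℂ :=
  (‖f (t : ℂ)‖ : ℂ) / (1 - (t : ℂ) * z)

/-- The sublinear Hilbert operator `H̃(f)(z) = ∫_0^1 |f(t)| / (1-tz) dt`. -/
def sublinearHilbertOperator (f : ℂ → ℂ) (z : ℂ) : ℂ :=
  ∫ t in (0 : ℝ)..1, sublinearHilbertIntegrand f z t

/-- A (not necessarily linear) operator is bounded on `D_v` if it maps `D_v` into itself and
`‖T f‖ ≤ C ‖f‖` with a finite constant `C` independent of `f ∈ D_v`. -/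
def IsBoundedOnDirichlet (v : ℂ → ℝ) (T : (ℂ → ℂ) → (ℂ → ℂ)) : Prop :=
  ∃ C : ℝ≥0, ∀ f : ℂ → ℂ, MemDirichlet v f →
    MemDirichlet v (T f) ∧ dirichletNorm v (T f) ≤ (C : ℝ≥0∞) * dirichletNorm v f

end

/-!
Write `v̂` for the tail integral of `v`. The proof replaces the space `D_v` by the weighted `L²`
space on the radius `(0, 1)` with weight `v̂(s) / (1 - s)²` (`radialWeight`), and all of the
analysis by weighted Hardy inequalities there.

*From `D_v` to the radius.* The Fejér–Riesz inequality (`fejer_riesz`), applied to `f'` on the disc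
of radius `r` and integrated against `v(r)`, gives `∫ |f'(s)|² v̂(s) ds ≲ ‖f‖²`. Since `|f(t)| ≤
|f(0)| + ∫_0^t |f'|`, Hardy's inequality with weights `v̂(s) / (1 - s)²` and `v̂(s)`, which is the
first Muckenhoupt-type condition, yields `∫ |f(t)|² v̂(t) / (1 - t)² dt ≲ ‖f‖²`
(`IsDoublingWeight.exists_radial_bound`).

*From the radius to `D_v`.* Both operators send `f` to `F(z) = ∫ h(t) / (1 - t z) dt` with `|h| =
|f|` on the radius, so that `|F'(z)| ≤ ∫ |f(t)| |1 - t z|⁻² dt`. The square mean of `|1 - t z|⁻²`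
over `|z| = r` is at most a constant times `(1 - t r)^(-3/2)`, by the Poisson kernel. Splitting the
integral at `t = r`, it remains to bound `∫_0^r |f(t)| (1 - t)^(-3/2) dt` and `(1 - r)^(-3/2) ∫_r^1
|f(t)| dt` in `L²(r v(r) dr)`. These are two further Hardy inequalities: the condition for one
follows from the first Muckenhoupt-type condition and the doubling property
(`IsDoublingWeight.exists_hardy_growth`), the condition for the other from the second
Muckenhoupt-type condition (`IsDoublingWeight.exists_hardy_tail`).

The Hardy inequality itself (`IsOrderKernel.hardy`) is proved in `[0, ∞]` for an arbitrary
measurable total preorder, by Tonelli's theorem and a truncation: with `H` the integral of `h` up to `s`,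
`U` the tail integral of `u` and `q = 1 / w`, the inequality `H² ≤ 2 ∫ h H` bounds both `∫ u H²`
and `∫ U² q H²` by multiples of `S = ∫ h H U`, and the pointwise arithmetic-geometric mean
inequality bounds `S` by `∫ h² w` and `∫ U² q H²`.

A radial weight is measurable only almost everywhere, so its restriction to the radius is replaced
by a measurable profile (`IsProfile`), which exists by Fubini's theorem in polar coordinates.
-/

/-! ### Weighted inequalities for integrals in `[0, ∞]` -/

lemma ENNReal.two_mul_le_add_of_sq_le_mul {a b c : ℝ≥0∞} (h : c ^ 2 ≤ a * b) :
    2 * c ≤ a + b := by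
  rcases eq_or_ne a ∞ with rfl | ha
  · simp
  rcases eq_or_ne b ∞ with rfl | hb
  · simp
  have hc : c ≠ ∞ := by
    rintro rfl
    have : (⊤ : ℝ≥0∞) ^ 2 ≠ ⊤ := ne_top_of_le_ne_top (ENNReal.mul_ne_top ha hb) h
    simp at this
  lift a to ℝ≥0 using ha
  lift b to ℝ≥0 using hb
  lift c to ℝ≥0 using hc
  norm_cast at h ⊢
  have h' : (c : ℝ) ^ 2 ≤ a * b := by exact_mod_cast h
  have : 2 * (c : ℝ) ≤ a + b := by
    nlinarith [sq_nonneg ((a : ℝ) - b), a.2, b.2, c.2, NNReal.coe_nonneg a, NNReal.coe_nonneg b,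
      NNReal.coe_nonneg c]
  exact_mod_cast this

lemma ENNReal.add_sq_le (a b : ℝ≥0∞) : (a + b) ^ 2 ≤ 2 * a ^ 2 + 2 * b ^ 2 := by
  have h : 2 * (a * b) ≤ a ^ 2 + b ^ 2 :=
    ENNReal.two_mul_le_add_of_sq_le_mul (le_of_eq (by ring))
  calc (a + b) ^ 2 = a ^ 2 + b ^ 2 + 2 * (a * b) := by ring
    _ ≤ a ^ 2 + b ^ 2 + (a ^ 2 + b ^ 2) := by gcongr
    _ = 2 * a ^ 2 + 2 * b ^ 2 := by ring

/-- The Cauchy–Schwarz inequality, with the square roots hidden in a pointwise hypothesis. -/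
lemma sq_lintegral_le_mul_lintegral {α : Type*} [MeasurableSpace α] {μ : Measure α}
    {a b c : α → ℝ≥0∞} (ha : AEMeasurable a μ) (hb : AEMeasurable b μ)
    (h : ∀ᵐ x ∂μ, c x ^ 2 ≤ a x * b x) :
    (∫⁻ x, c x ∂μ) ^ 2 ≤ (∫⁻ x, a x ∂μ) * ∫⁻ x, b x ∂μ := by
  have hhalf : ∀ y : ℝ≥0∞, (y ^ (1 / 2 : ℝ)) ^ (2 : ℝ) = y := fun y ↦ by
    rw [← ENNReal.rpow_mul]; norm_num
  have hc : ∀ᵐ x ∂μ, c x ≤ a x ^ (1 / 2 : ℝ) * b x ^ (1 / 2 : ℝ) := by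
    filter_upwards [h] with x hx
    rw [← ENNReal.mul_rpow_of_nonneg _ _ (by norm_num)]
    calc c x = (c x ^ (2 : ℝ)) ^ (1 / 2 : ℝ) := by rw [← ENNReal.rpow_mul]; norm_num
      _ ≤ _ := by
        gcongr
        simpa using hx
  have key := ENNReal.lintegral_mul_le_Lp_mul_Lq μ (p := 2) (q := 2)
    (Real.HolderConjugate.two_two) (ha.pow_const (1 / 2 : ℝ)) (hb.pow_const (1 / 2 : ℝ))
  simp only [Pi.mul_apply] at key
  simp_rw [hhalf] at key
  calc (∫⁻ x, c x ∂μ) ^ 2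
      ≤ ((∫⁻ x, a x ∂μ) ^ (1 / 2 : ℝ) * (∫⁻ x, b x ∂μ) ^ (1 / 2 : ℝ)) ^ 2 := by
        gcongr
        exact (lintegral_mono_ae hc).trans key
    _ = _ := by
        rw [mul_pow, ← ENNReal.rpow_natCast, ← ENNReal.rpow_natCast]
        norm_num [hhalf, ← ENNReal.rpow_mul]

section Hardy

variable {α : Type*} [MeasurableSpace α] {μ : Measure α} {k : α → α → ℝ≥0∞}

/-- `k` is the indicator function of a measurable total preorder: `k t s` is `1` if `t` precedes
`s` and `0` otherwise. Only the inequalities that express totality and transitivity are recorded,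
so that both `t ≤ s` and `s ≤ t` on the line are instances. -/
structure IsOrderKernel (k : α → α → ℝ≥0∞) : Prop where
  measurable : Measurable fun p : α × α ↦ k p.1 p.2
  le_one : ∀ t s, k t s ≤ 1
  total : ∀ t s, 1 ≤ k t s + k s t
  trans_right : ∀ t s x, k t s * k s x ≤ k t x * k s x
  trans_left : ∀ t s x, k t s * k s x ≤ k t x * k t s

namespace IsOrderKernel

lemma swap_measurable (hk : IsOrderKernel k) : Measurable fun p : α × α ↦ k p.2 p.1 :=
  hk.measurable.comp measurable_swap

lemma measurable_left (hk : IsOrderKernel k) (s : α) : Measurable fun t ↦ k t s :=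
  hk.measurable.comp measurable_prodMk_right

lemma measurable_right (hk : IsOrderKernel k) (t : α) : Measurable fun s ↦ k t s :=
  hk.measurable.comp measurable_prodMk_left

variable [SFinite μ]

lemma measurable_lintegral_left (hk : IsOrderKernel k) {h : α → ℝ≥0∞} (hh : Measurable h) :
    Measurable fun s ↦ ∫⁻ t, k t s * h t ∂μ :=
  Measurable.lintegral_prod_right' (f := fun p : α × α ↦ k p.2 p.1 * h p.2)
    (hk.swap_measurable.fun_mul (hh.comp measurable_snd))

lemma measurable_lintegral_right (hk : IsOrderKernel k) {u : α → ℝ≥0∞} (hu : Measurable u) :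
    Measurable fun t ↦ ∫⁻ s, k t s * u s ∂μ :=
  Measurable.lintegral_prod_right' (f := fun p : α × α ↦ k p.1 p.2 * u p.2)
    (hk.measurable.fun_mul (hu.comp measurable_snd))

lemma swap (hk : IsOrderKernel k) : IsOrderKernel fun t s ↦ k s t where
  measurable := hk.swap_measurable
  le_one t s := hk.le_one s t
  total t s := hk.total s t
  trans_right t s x := by rw [mul_comm]; exact hk.trans_left x s t
  trans_left t s x := by rw [mul_comm]; exact hk.trans_right x s t

/-- Tonelli's theorem for the triangle on which `k` is supported. -/
lemma lintegral_mul_lintegral (hk : IsOrderKernel k) {a b : α → ℝ≥0∞} (ha : Measurable a)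
    (hb : Measurable b) :
    ∫⁻ s, a s * ∫⁻ t, k t s * b t ∂μ ∂μ = ∫⁻ t, b t * ∫⁻ s, k t s * a s ∂μ ∂μ := by
  have e1 : ∀ s, a s * ∫⁻ t, k t s * b t ∂μ = ∫⁻ t, a s * (k t s * b t) ∂μ := fun s ↦
    (lintegral_const_mul _ ((hk.measurable_left s).fun_mul hb)).symm
  have e2 : ∀ t, b t * ∫⁻ s, k t s * a s ∂μ = ∫⁻ s, b t * (k t s * a s) ∂μ := fun t ↦
    (lintegral_const_mul _ ((hk.measurable_right t).fun_mul ha)).symm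
  simp_rw [e1, e2]
  rw [lintegral_lintegral_swap]
  · congr! 4 with t s
    ring
  · exact ((ha.comp measurable_fst).mul
      (hk.swap_measurable.fun_mul (hb.comp measurable_snd))).aemeasurable

/-- The square of a primitive is at most twice the integral of the function times its primitive:
the square `{(t, t') : t, t' before s}` is covered by two triangles. -/
lemma sq_lintegral_le (hk : IsOrderKernel k) {h : α → ℝ≥0∞} (hh : Measurable h) (s : α) :
    (∫⁻ t, k t s * h t ∂μ) ^ 2
      ≤ 2 * ∫⁻ t, k t s * (h t * ∫⁻ t', k t' t * h t' ∂μ) ∂μ := by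
  set g : α → ℝ≥0∞ := fun t ↦ k t s * h t with hg
  have hgm : Measurable g := (hk.measurable_left s).fun_mul hh
  have hgh : ∀ t, g t ≤ h t := fun t ↦ by
    simpa using mul_le_mul_left (hk.le_one t s) (h t)
  have e : (∫⁻ t, g t ∂μ) ^ 2 = ∫⁻ t, g t * ∫⁻ t', g t' ∂μ ∂μ := by
    rw [lintegral_mul_const _ hgm, sq]
  have hsplit : ∀ t, ∫⁻ t', g t' ∂μ ≤ (∫⁻ t', k t' t * g t' ∂μ) + ∫⁻ t', k t t' * g t' ∂μ := by
    intro t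
    rw [← lintegral_add_left ((hk.measurable_left t).fun_mul hgm)]
    refine lintegral_mono fun t' ↦ ?_
    simpa [add_mul] using mul_le_mul_left (hk.total t' t) (g t')
  calc (∫⁻ t, g t ∂μ) ^ 2
      ≤ ∫⁻ t, g t * ((∫⁻ t', k t' t * g t' ∂μ) + ∫⁻ t', k t t' * g t' ∂μ) ∂μ := by
        rw [e]
        exact lintegral_mono fun t ↦ by gcongr; exact hsplit t
    _ = (∫⁻ t, g t * ∫⁻ t', k t' t * g t' ∂μ ∂μ) + ∫⁻ t, g t * ∫⁻ t', k t t' * g t' ∂μ ∂μ := by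
        simp_rw [mul_add]
        exact lintegral_add_left (hgm.fun_mul (hk.measurable_lintegral_left hgm)) _
    _ = 2 * ∫⁻ t, g t * ∫⁻ t', k t' t * g t' ∂μ ∂μ := by
        rw [← hk.lintegral_mul_lintegral hgm hgm, two_mul]
    _ ≤ 2 * ∫⁻ t, k t s * (h t * ∫⁻ t', k t' t * h t' ∂μ) ∂μ := by
        refine mul_le_mul' le_rfl (lintegral_mono fun t ↦ ?_)
        rw [← mul_assoc]
        refine mul_le_mul' le_rfl (lintegral_mono fun t' ↦ ?_)
        exact mul_le_mul' le_rfl (hgh t')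

/-- If `U * W ≤ B`, where `U` is the tail integral of `u` and `W` the initial integral of `q`,
then the tail integrals of `U ^ 2 * q` are at most `2 * B * U`. -/
lemma lintegral_sq_tail_le (hk : IsOrderKernel k)
    {u q : α → ℝ≥0∞} (hu : Measurable u) (hq : Measurable q) {B : ℝ≥0∞}
    (hB : ∀ᵐ x ∂μ, (∫⁻ s, k x s * u s ∂μ) * (∫⁻ t, k t x * q t ∂μ) ≤ B) (t : α) :
    ∫⁻ s, k t s * ((∫⁻ x, k s x * u x ∂μ) ^ 2 * q s) ∂μ ≤ 2 * B * ∫⁻ s, k t s * u s ∂μ := by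
  set U : α → ℝ≥0∞ := fun s ↦ ∫⁻ x, k s x * u x ∂μ with hU
  have hUm : Measurable U := hk.measurable_lintegral_right hu
  have hsw := hk.swap
  calc ∫⁻ s, k t s * (U s ^ 2 * q s) ∂μ
      ≤ ∫⁻ s, k t s * ((2 * ∫⁻ x, k s x * (u x * U x) ∂μ) * q s) ∂μ := by
        gcongr with s
        exact hsw.sq_lintegral_le hu s
    _ = 2 * ∫⁻ s, q s * ∫⁻ x, k t s * k s x * (u x * U x) ∂μ ∂μ := by
        rw [← lintegral_const_mul']
        swap
        · simp
        congr! 2 with s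
        have : ∫⁻ x, k t s * k s x * (u x * U x) ∂μ = k t s * ∫⁻ x, k s x * (u x * U x) ∂μ := by
          rw [← lintegral_const_mul _ ((hk.measurable_right s).fun_mul (hu.fun_mul hUm))]
          simp_rw [mul_assoc]
        rw [this]
        ring
    _ ≤ 2 * ∫⁻ s, q s * ∫⁻ x, k s x * (k t x * (u x * U x)) ∂μ ∂μ := by
        refine mul_le_mul' le_rfl (lintegral_mono fun s ↦ mul_le_mul' le_rfl
          (lintegral_mono fun x ↦ ?_))
        rw [← mul_assoc (k s x), mul_comm (k s x) (k t x)]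
        refine mul_le_mul' ?_ le_rfl
        exact hk.trans_right t s x
    _ = 2 * ∫⁻ x, k t x * (u x * U x) * ∫⁻ s, k s x * q s ∂μ ∂μ := by
        rw [← hk.lintegral_mul_lintegral ((hk.measurable_right t).fun_mul (hu.fun_mul hUm)) hq]
    _ ≤ 2 * ∫⁻ x, B * (k t x * u x) ∂μ := by
        gcongr 2 * ?_
        refine lintegral_mono_ae ?_
        filter_upwards [hB] with x hx
        calc k t x * (u x * U x) * ∫⁻ s, k s x * q s ∂μ
            = (U x * ∫⁻ s, k s x * q s ∂μ) * (k t x * u x) := by ring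
          _ ≤ _ := by gcongr
    _ = _ := by
        rw [lintegral_const_mul _ ((hk.measurable_right t).fun_mul hu), mul_assoc]

/-- The weighted Hardy inequality for functions for which the pairing `∫ h H U` is known to be
finite. -/
lemma hardy_of_finite (hk : IsOrderKernel k)
    {u w q h : α → ℝ≥0∞} (hu : Measurable u) (hw : Measurable w) (hq : Measurable q)
    (hh : Measurable h) (hwq : ∀ᵐ x ∂μ, 1 ≤ w x * q x) {B : ℝ≥0∞} (hB0 : B ≠ 0) (hB1 : B ≠ ∞)
    (hB : ∀ᵐ x ∂μ, (∫⁻ s, k x s * u s ∂μ) * (∫⁻ t, k t x * q t ∂μ) ≤ B)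
    (hfin : ∫⁻ t, h t * (∫⁻ t', k t' t * h t' ∂μ) * (∫⁻ s, k t s * u s ∂μ) ∂μ ≠ ∞) :
    ∫⁻ s, u s * (∫⁻ t, k t s * h t ∂μ) ^ 2 ∂μ ≤ 8 * B * ∫⁻ t, h t ^ 2 * w t ∂μ := by
  set U : α → ℝ≥0∞ := fun s ↦ ∫⁻ x, k s x * u x ∂μ with hU
  set H : α → ℝ≥0∞ := fun s ↦ ∫⁻ t, k t s * h t ∂μ with hH
  have hUm : Measurable U := hk.measurable_lintegral_right hu
  have hHm : Measurable H := hk.measurable_lintegral_left hh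
  set S := ∫⁻ t, h t * H t * U t ∂μ with hS
  set Y := ∫⁻ t, h t ^ 2 * w t ∂μ with hY
  set Z := ∫⁻ s, (U s ^ 2 * q s) * H s ^ 2 ∂μ with hZ
  have main : ∀ a : α → ℝ≥0∞, Measurable a → ∫⁻ s, a s * H s ^ 2 ∂μ
      ≤ 2 * ∫⁻ t, h t * H t * ∫⁻ s, k t s * a s ∂μ ∂μ := fun a ha ↦ by
    calc ∫⁻ s, a s * H s ^ 2 ∂μ ≤ ∫⁻ s, a s * (2 * ∫⁻ t, k t s * (h t * H t) ∂μ) ∂μ := by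
          gcongr with s
          exact hk.sq_lintegral_le hh s
      _ = 2 * ∫⁻ s, a s * ∫⁻ t, k t s * (h t * H t) ∂μ ∂μ := by
          rw [← lintegral_const_mul' _ _ (by simp)]
          congr! 2 with s
          ring
      _ = _ := by rw [hk.lintegral_mul_lintegral ha (hh.fun_mul hHm)]
  have hX : ∫⁻ s, u s * H s ^ 2 ∂μ ≤ 2 * S := main u hu
  have hZS : Z ≤ 4 * B * S := by
    calc Z ≤ 2 * ∫⁻ t, h t * H t * ∫⁻ s, k t s * (U s ^ 2 * q s) ∂μ ∂μ :=
          main _ ((hUm.pow_const 2).fun_mul hq)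
      _ ≤ 2 * ∫⁻ t, h t * H t * (2 * B * U t) ∂μ := by
          gcongr with t
          exact hk.lintegral_sq_tail_le  hu hq hB t
      _ = 2 * ∫⁻ t, 2 * B * (h t * H t * U t) ∂μ := by
          congr! 3 with t
          ring
      _ = 4 * B * S := by
          rw [lintegral_const_mul _ ((hh.fun_mul hHm).fun_mul hUm)]
          ring
  -- With the weight `4 * B` in the arithmetic-geometric mean inequality, the bound for `Z`
  -- contributes exactly `S`, which is absorbed by the left-hand side.
  have hSYZ : 2 * S ≤ 4 * B * Y + (4 * B)⁻¹ * Z := by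
    rw [hS, hY, hZ, ← lintegral_const_mul _ ((hh.fun_mul hHm).fun_mul hUm),
      ← lintegral_const_mul _ ((hh.pow_const 2).fun_mul hw),
      ← lintegral_const_mul _ (((hUm.pow_const 2).fun_mul hq).fun_mul (hHm.pow_const 2)),
      ← lintegral_add_left (((hh.pow_const 2).fun_mul hw).const_mul _)]
    refine lintegral_mono_ae ?_
    filter_upwards [hwq] with x hx
    refine ENNReal.two_mul_le_add_of_sq_le_mul ?_
    calc (h x * H x * U x) ^ 2 ≤ (h x * H x * U x) ^ 2 * (w x * q x) := le_mul_of_one_le_right' hx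
      _ = 4 * B * (4 * B)⁻¹ * ((h x * H x * U x) ^ 2 * (w x * q x)) := by
          rw [ENNReal.mul_inv_cancel (by simp [hB0]) (ENNReal.mul_ne_top (by simp) hB1), one_mul]
      _ = _ := by ring
  have hSS : 2 * S ≤ 4 * B * Y + S := by
    refine hSYZ.trans ?_
    gcongr
    calc (4 * B)⁻¹ * Z ≤ (4 * B)⁻¹ * (4 * B * S) := by gcongr
      _ = S := by
        rw [← mul_assoc, ENNReal.inv_mul_cancel (by simp [hB0]) (ENNReal.mul_ne_top (by simp) hB1),
          one_mul]
  rw [two_mul] at hSS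
  have hS4 : S ≤ 4 * B * Y := (ENNReal.add_le_add_iff_right hfin).1 hSS
  calc _ ≤ 2 * S := hX
    _ ≤ 2 * (4 * B * Y) := by gcongr
    _ = _ := by ring

/-- **Muckenhoupt's weighted Hardy inequality** for `p = 2`, with respect to a total preorder. -/
lemma hardy [IsFiniteMeasure μ] (hk : IsOrderKernel k)
    {u w q h : α → ℝ≥0∞} (hu : Measurable u) (hw : Measurable w) (hq : Measurable q)
    (hh : Measurable h) (hwq : ∀ᵐ x ∂μ, 1 ≤ w x * q x) {B : ℝ≥0∞} (hB0 : B ≠ 0) (hB1 : B ≠ ∞)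
    (hB : ∀ᵐ x ∂μ, (∫⁻ s, k x s * u s ∂μ) * (∫⁻ t, k t x * q t ∂μ) ≤ B)
    (hUfin : ∀ᵐ x ∂μ, ∫⁻ s, k x s * u s ∂μ ≠ ∞) :
    ∫⁻ s, u s * (∫⁻ t, k t s * h t ∂μ) ^ 2 ∂μ ≤ 8 * B * ∫⁻ t, h t ^ 2 * w t ∂μ := by
  set U : α → ℝ≥0∞ := fun s ↦ ∫⁻ x, k s x * u x ∂μ with hU
  have hUm : Measurable U := hk.measurable_lintegral_right hu
  -- Truncating `h` in height and to sets on which `U` is bounded makes `∫ h H U` finite.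
  set hn : ℕ → α → ℝ≥0∞ := fun n ↦ {x | U x ≤ n}.indicator fun x ↦ min (h x) n with hhn
  have hnm : ∀ n, Measurable (hn n) := fun n ↦
    (hh.min measurable_const).indicator (measurableSet_le hUm measurable_const)
  have hn_le : ∀ n x, hn n x ≤ h x := fun n x ↦
    (indicator_le_self _ _ x).trans (min_le_left _ _)
  have hn_mono : ∀ x, Monotone fun n ↦ hn n x := fun x m n hmn ↦ by
    have hmn' : (m : ℝ≥0∞) ≤ n := by exact_mod_cast hmn
    simp only [hhn, indicator_apply, mem_ofPred_eq]
    split_ifs with h1 h2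
    · exact min_le_min_left _ hmn'
    · exact absurd (h1.trans hmn') h2
    · simp
    · simp
  have hn_tendsto : ∀ᵐ x ∂μ, Filter.Tendsto (fun n ↦ hn n x) Filter.atTop (nhds (h x)) := by
    filter_upwards [hUfin] with x hx
    obtain ⟨N, hN⟩ := ENNReal.exists_nat_gt hx
    have e : (fun n : ℕ ↦ min (h x) (n : ℝ≥0∞)) =ᶠ[Filter.atTop] fun n ↦ hn n x := by
      filter_upwards [Filter.eventually_ge_atTop N] with n hNn
      have : U x ≤ n := hN.le.trans (by exact_mod_cast hNn)
      simp [hhn, this]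
    refine Filter.Tendsto.congr' e ?_
    simpa using (tendsto_const_nhds (x := h x)).min ENNReal.tendsto_nat_nhds_top
  have hfin : ∀ n, ∫⁻ t, hn n t * (∫⁻ t', k t' t * hn n t' ∂μ) * U t ∂μ ≠ ∞ := fun n ↦ by
    have hle : ∀ t, hn n t ≤ n := fun t ↦ (indicator_le_self _ _ t).trans (min_le_right _ _)
    have hH : ∀ t, ∫⁻ t', k t' t * hn n t' ∂μ ≤ n * μ univ := fun t ↦ by
      calc ∫⁻ t', k t' t * hn n t' ∂μ ≤ ∫⁻ t', 1 * n ∂μ := by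
            gcongr with t'
            · exact hk.le_one t' t
            · exact hle t'
        _ = _ := by simp
    have : ∀ t, hn n t * (∫⁻ t', k t' t * hn n t' ∂μ) * U t ≤ n * (n * μ univ) * n := fun t ↦ by
      by_cases ht : U t ≤ n
      · gcongr
        · exact hle t
        · exact hH t
      · simp [hhn, indicator_apply, ht]
    refine ne_top_of_le_ne_top ?_ (lintegral_mono this)
    rw [lintegral_const]
    finiteness
  have hbound : ∀ n, ∫⁻ s, u s * (∫⁻ t, k t s * hn n t ∂μ) ^ 2 ∂μ
      ≤ 8 * B * ∫⁻ t, h t ^ 2 * w t ∂μ := fun n ↦ by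
    refine (hk.hardy_of_finite  hu hw hq (hnm n) hwq hB0 hB1 hB (hfin n)).trans ?_
    gcongr with t
    exact hn_le n t
  have hlim : ∀ s, Filter.Tendsto (fun n ↦ ∫⁻ t, k t s * hn n t ∂μ) Filter.atTop
      (nhds (∫⁻ t, k t s * h t ∂μ)) := fun s ↦ by
    refine lintegral_tendsto_of_tendsto_of_monotone
      (fun n ↦ ((hk.measurable_left s).fun_mul (hnm n)).aemeasurable) ?_ ?_
    · exact .of_forall fun t m n hmn ↦ mul_le_mul' le_rfl (hn_mono t hmn)
    · filter_upwards [hn_tendsto] with t ht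
      exact ENNReal.Tendsto.const_mul ht (Or.inr (ne_top_of_le_ne_top (by simp) (hk.le_one t s)))
  calc ∫⁻ s, u s * (∫⁻ t, k t s * h t ∂μ) ^ 2 ∂μ
      ≤ ∫⁻ s, ⨆ n, u s * (∫⁻ t, k t s * hn n t ∂μ) ^ 2 ∂μ := by
        gcongr with s
        rw [← ENNReal.mul_iSup]
        gcongr
        refine le_of_tendsto' (((ENNReal.continuous_pow 2).tendsto _).comp (hlim s)) fun n ↦ ?_
        exact le_iSup (fun n ↦ (∫⁻ t, k t s * hn n t ∂μ) ^ 2) n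
    _ = ⨆ n, ∫⁻ s, u s * (∫⁻ t, k t s * hn n t ∂μ) ^ 2 ∂μ := by
        refine lintegral_iSup
          (fun n ↦ hu.fun_mul ((hk.measurable_lintegral_left (hnm n)).pow_const 2)) ?_
        intro m n hmn s
        dsimp only
        gcongr with t
        exact hn_mono t hmn
    _ ≤ _ := iSup_le hbound

end IsOrderKernel

end Hardy

/-! ### Hardy inequalities on the interval `(0, 1)` -/

/-- The indicator function of `t ≤ s` on the line. -/
noncomputable def leKernel (t s : ℝ) : ℝ≥0∞ := (Iic s).indicator 1 t

lemma isOrderKernel_leKernel : IsOrderKernel leKernel where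
  measurable := by
    have : MeasurableSet {p : ℝ × ℝ | p.1 ≤ p.2} := measurableSet_le measurable_fst measurable_snd
    exact (measurable_one (α := ℝ≥0∞)).indicator this
  le_one t s := indicator_le_self' (by simp) t
  total t s := by
    rcases le_total t s with h | h <;> simp [leKernel, h]
  trans_right t s x := by
    by_cases h1 : t ≤ s <;> by_cases h2 : s ≤ x <;> simp [leKernel, h1, h2]
    simp [h1.trans h2]
  trans_left t s x := by
    by_cases h1 : t ≤ s <;> by_cases h2 : s ≤ x <;> simp [leKernel, h1, h2]
    simp [h1.trans h2]

lemma lintegral_leKernel_left {s : ℝ} (hs : s ∈ Ioo (0 : ℝ) 1) (h : ℝ → ℝ≥0∞) :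
    ∫⁻ t in Ioo 0 1, leKernel t s * h t = ∫⁻ t in Ioo 0 s, h t := by
  have e : ∀ t, leKernel t s * h t = (Iic s).indicator h t := fun t ↦ by
    by_cases ht : t ≤ s <;> simp [leKernel, ht]
  simp_rw [e]
  rw [lintegral_indicator measurableSet_Iic, Measure.restrict_restrict measurableSet_Iic]
  have : Iic s ∩ Ioo 0 1 = Ioc 0 s := by
    ext t
    simp only [mem_inter_iff, mem_Iic, mem_Ioo, mem_Ioc]
    grind
  rw [this, restrict_Ioo_eq_restrict_Ioc]

lemma lintegral_leKernel_right {s : ℝ} (hs : s ∈ Ioo (0 : ℝ) 1) (h : ℝ → ℝ≥0∞) :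
    ∫⁻ t in Ioo 0 1, leKernel s t * h t = ∫⁻ t in Ioo s 1, h t := by
  have e : ∀ t, leKernel s t * h t = (Ici s).indicator h t := fun t ↦ by
    by_cases ht : s ≤ t <;> simp [leKernel, ht]
  simp_rw [e]
  rw [lintegral_indicator measurableSet_Ici, Measure.restrict_restrict measurableSet_Ici]
  have : Ici s ∩ Ioo 0 1 = Ico s 1 := by
    ext t
    simp only [mem_inter_iff, mem_Ici, mem_Ioo, mem_Ico]
    grind
  rw [this, restrict_Ioo_eq_restrict_Ico]

/-- Tonelli's theorem on the triangle `{0 < t < s < 1}`. -/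
lemma lintegral_Ioo_mul_lintegral_Ioo {a b : ℝ → ℝ≥0∞} (ha : Measurable a) (hb : Measurable b) :
    ∫⁻ s in Ioo (0 : ℝ) 1, a s * ∫⁻ t in Ioo 0 s, b t
      = ∫⁻ t in Ioo (0 : ℝ) 1, b t * ∫⁻ s in Ioo t 1, a s := by
  have key := isOrderKernel_leKernel.lintegral_mul_lintegral
    (μ := volume.restrict (Ioo (0 : ℝ) 1)) ha hb
  refine ((setLIntegral_congr_fun measurableSet_Ioo fun s hs ↦ ?_).trans key).trans
    (setLIntegral_congr_fun measurableSet_Ioo fun t ht ↦ ?_)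
  · simp only [lintegral_leKernel_left hs]
  · simp only [lintegral_leKernel_right ht]

lemma measurable_lintegral_Ioo_left (u : ℝ → ℝ≥0∞) :
    Measurable fun s ↦ ∫⁻ t in Ioo 0 s, u t := by
  have : Monotone fun s : ℝ ↦ ∫⁻ t in Ioo 0 s, u t := fun a b hab ↦
    lintegral_mono_set (Ioo_subset_Ioo_right hab)
  exact this.measurable

/-- The weighted Hardy inequality for integrals from `0`. -/
lemma exists_hardy_left {u w q : ℝ → ℝ≥0∞} (hu : Measurable u) (hw : Measurable w)
    (hq : Measurable q) (hwq : ∀ x ∈ Ioo (0 : ℝ) 1, 1 ≤ w x * q x) {B : ℝ≥0∞} (hB1 : B ≠ ∞)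
    (hB : ∀ x ∈ Ioo (0 : ℝ) 1, (∫⁻ s in Ioo x 1, u s) * (∫⁻ t in Ioo 0 x, q t) ≤ B)
    (hU : ∀ x ∈ Ioo (0 : ℝ) 1, ∫⁻ s in Ioo x 1, u s ≠ ∞) :
    ∃ C : ℝ≥0, ∀ h : ℝ → ℝ≥0∞, Measurable h →
      ∫⁻ s in Ioo (0 : ℝ) 1, u s * (∫⁻ t in Ioo 0 s, h t) ^ 2
        ≤ C * ∫⁻ t in Ioo (0 : ℝ) 1, h t ^ 2 * w t := by
  have hae : ∀ {P : ℝ → Prop}, (∀ x ∈ Ioo (0 : ℝ) 1, P x) →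
      ∀ᵐ x ∂(volume.restrict (Ioo (0 : ℝ) 1)), P x := fun h ↦
    (ae_restrict_iff' measurableSet_Ioo).2 (.of_forall h)
  refine ⟨(8 * (B + 1)).toNNReal, fun h hh ↦ ?_⟩
  rw [ENNReal.coe_toNNReal (by finiteness)]
  have key := isOrderKernel_leKernel.hardy (μ := volume.restrict (Ioo (0 : ℝ) 1)) hu hw hq hh
    (hae hwq) (B := B + 1) (by simp) (by finiteness)
    (hae fun x hx ↦ by
      rw [lintegral_leKernel_right hx, lintegral_leKernel_left hx]
      exact (hB x hx).trans le_self_add)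
    (hae fun x hx ↦ by
      rw [lintegral_leKernel_right hx]
      exact hU x hx)
  refine (setLIntegral_congr_fun measurableSet_Ioo fun s hs ↦ ?_).le.trans key
  simp only [lintegral_leKernel_left hs]

/-- The weighted Hardy inequality for integrals up to `1`. -/
lemma exists_hardy_right {u w q : ℝ → ℝ≥0∞} (hu : Measurable u) (hw : Measurable w)
    (hq : Measurable q) (hwq : ∀ x ∈ Ioo (0 : ℝ) 1, 1 ≤ w x * q x) {B : ℝ≥0∞} (hB1 : B ≠ ∞)
    (hB : ∀ x ∈ Ioo (0 : ℝ) 1, (∫⁻ s in Ioo 0 x, u s) * (∫⁻ t in Ioo x 1, q t) ≤ B)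
    (hU : ∀ x ∈ Ioo (0 : ℝ) 1, ∫⁻ s in Ioo 0 x, u s ≠ ∞) :
    ∃ C : ℝ≥0, ∀ h : ℝ → ℝ≥0∞, Measurable h →
      ∫⁻ s in Ioo (0 : ℝ) 1, u s * (∫⁻ t in Ioo s 1, h t) ^ 2
        ≤ C * ∫⁻ t in Ioo (0 : ℝ) 1, h t ^ 2 * w t := by
  have hae : ∀ {P : ℝ → Prop}, (∀ x ∈ Ioo (0 : ℝ) 1, P x) →
      ∀ᵐ x ∂(volume.restrict (Ioo (0 : ℝ) 1)), P x := fun h ↦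
    (ae_restrict_iff' measurableSet_Ioo).2 (.of_forall h)
  refine ⟨(8 * (B + 1)).toNNReal, fun h hh ↦ ?_⟩
  rw [ENNReal.coe_toNNReal (by finiteness)]
  have key := isOrderKernel_leKernel.swap.hardy (μ := volume.restrict (Ioo (0 : ℝ) 1)) hu hw hq hh
    (hae hwq) (B := B + 1) (by simp) (by finiteness)
    (hae fun x hx ↦ by
      rw [lintegral_leKernel_right hx, lintegral_leKernel_left hx]
      exact (hB x hx).trans le_self_add)
    (hae fun x hx ↦ by
      rw [lintegral_leKernel_left hx]
      exact hU x hx)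
  refine (setLIntegral_congr_fun measurableSet_Ioo fun s hs ↦ ?_).le.trans key
  simp only [lintegral_leKernel_right hs]

/-! ### Integrals over circles: the Fejér–Riesz inequality and the Poisson kernel -/

lemma circleMap_mem_unitDisc {r : ℝ} (hr : r ∈ Ioo (0 : ℝ) 1) (θ : ℝ) :
    circleMap 0 r θ ∈ unitDisc := by
  simp [unitDisc, abs_of_pos hr.1, hr.2]

lemma continuous_comp_circleMap {g : ℂ → ℂ} (hg : ContinuousOn g unitDisc) {r : ℝ}
    (hr : r ∈ Ioo (0 : ℝ) 1) : Continuous fun θ ↦ g (circleMap 0 r θ) :=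
  hg.comp_continuous (continuous_circleMap 0 r) fun θ ↦ circleMap_mem_unitDisc hr θ

open Real in
/-- The Fejér–Riesz inequality for `p = 2`. The product of `g` with its reflection in the real
axis is holomorphic and equals `|g|²` on the real axis; by Cauchy's theorem its integral over the
diameter of the disc of radius `r` equals the one over a half circle. -/
lemma intervalIntegral_norm_sq_le {g : ℂ → ℂ} (hg : DifferentiableOn ℂ g unitDisc) {r : ℝ}
    (hr : r ∈ Ioo (0 : ℝ) 1) :
    ∫ s in -r..r, ‖g s‖ ^ 2 ≤ r * ∫ θ in -π..π, ‖g (circleMap 0 r θ)‖ ^ 2 := by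
  set F : ℂ → ℂ := fun z ↦ g z * (starRingEnd ℂ) (g ((starRingEnd ℂ) z)) with hF
  have hgd : ∀ z ∈ unitDisc, DifferentiableAt ℂ g z := fun z hz ↦
    (hg z hz).differentiableAt (Metric.isOpen_ball.mem_nhds hz)
  have hconj : ∀ z ∈ unitDisc, (starRingEnd ℂ) z ∈ unitDisc := fun z hz ↦ by
    simpa [unitDisc] using hz
  have hFd : DifferentiableOn ℂ F unitDisc := fun z hz ↦ by
    have h2 := (hgd _ (hconj z hz)).hasDerivAt.conj_conj
    rw [Complex.conj_conj] at h2
    exact ((hgd z hz).mul h2.differentiableAt).differentiableWithinAt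
  obtain ⟨G, hG⟩ := DifferentiableOn.isExactOn_ball (c := 0) (r := 1) hFd
  have hc : Continuous fun θ ↦ g (circleMap 0 r θ) := continuous_comp_circleMap hg.continuousOn hr
  have hFc : Continuous fun θ ↦ F (circleMap 0 r θ) := continuous_comp_circleMap hFd.continuousOn hr
  have hmem : ∀ s ∈ uIcc (-r) r, (s : ℂ) ∈ unitDisc := fun s hs ↦ by
    rw [uIcc_of_le (by linarith [hr.1])] at hs
    simp only [unitDisc, Metric.mem_ball, dist_zero_right, Complex.norm_real, Real.norm_eq_abs]
    exact lt_of_le_of_lt (abs_le.2 hs) hr.2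
  have hdiam : ∫ s in -r..r, F (s : ℂ) = G r - G (-r) := by
    have := intervalIntegral.integral_eq_sub_of_hasDerivAt (f := fun s : ℝ ↦ G s)
      (f' := fun s : ℝ ↦ F s) (a := -r) (b := r)
      (fun s hs ↦ (hG s (hmem s hs)).comp_ofReal)
      (ContinuousOn.intervalIntegrable (hFd.continuousOn.comp (by fun_prop) hmem))
    simpa using this
  have harc : ∫ θ in (0 : ℝ)..π, F (circleMap 0 r θ) * (circleMap 0 r θ * Complex.I)
      = G (-r) - G r := by
    have := intervalIntegral.integral_eq_sub_of_hasDerivAt (f := fun θ : ℝ ↦ G (circleMap 0 r θ))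
      (f' := fun θ : ℝ ↦ F (circleMap 0 r θ) * (circleMap 0 r θ * Complex.I)) (a := 0) (b := π)
      (fun θ _ ↦ (hG _ (circleMap_mem_unitDisc hr θ)).comp θ (hasDerivAt_circleMap 0 r θ))
      (Continuous.intervalIntegrable
        (hFc.mul ((continuous_circleMap 0 r).mul continuous_const)) _ _)
    simpa [circleMap] using this
  have hreal : ∀ s : ℝ, F s = ((‖g s‖ ^ 2 : ℝ) : ℂ) := fun s ↦ by
    simp only [hF, Complex.conj_ofReal, Complex.mul_conj, Complex.normSq_eq_norm_sq]
  have h1 : ∫ s in -r..r, ‖g s‖ ^ 2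
      = ‖∫ θ in (0 : ℝ)..π, F (circleMap 0 r θ) * (circleMap 0 r θ * Complex.I)‖ := by
    rw [harc, ← norm_neg, neg_sub, ← hdiam]
    simp_rw [hreal]
    rw [intervalIntegral.integral_ofReal, Complex.norm_real, Real.norm_eq_abs, abs_of_nonneg]
    exact intervalIntegral.integral_nonneg (by linarith [hr.1]) fun s _ ↦ by positivity
  have h2 : ∫ θ in -π..π, ‖g (circleMap 0 r θ)‖ ^ 2
      = ∫ θ in (0 : ℝ)..π, (‖g (circleMap 0 r θ)‖ ^ 2 + ‖g (circleMap 0 r (-θ))‖ ^ 2) := by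
    have hc' : Continuous fun θ ↦ g (circleMap 0 r (-θ)) := hc.comp continuous_neg
    rw [intervalIntegral.integral_add ((hc.norm.fun_pow 2).intervalIntegrable _ _)
      ((hc'.norm.fun_pow 2).intervalIntegrable _ _),
      intervalIntegral.integral_comp_neg (fun θ ↦ ‖g (circleMap 0 r θ)‖ ^ 2), neg_zero, add_comm]
    exact (intervalIntegral.integral_add_adjacent_intervals
      ((hc.norm.fun_pow 2).intervalIntegrable _ _)
      ((hc.norm.fun_pow 2).intervalIntegrable _ _)).symm
  rw [h1, h2, ← intervalIntegral.integral_const_mul]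
  refine intervalIntegral.norm_integral_le_of_norm_le pi_pos.le (.of_forall fun θ _ ↦ ?_)
    (Continuous.intervalIntegrable ?_ _ _)
  · have : ‖F (circleMap 0 r θ) * (circleMap 0 r θ * Complex.I)‖
        = ‖g (circleMap 0 r θ)‖ * ‖g (circleMap 0 r (-θ))‖ * r := by
      simp [hF, conj_circleMap_zero, abs_of_pos hr.1]
    rw [this]
    have h3 := mul_nonneg (norm_nonneg (g (circleMap 0 r θ))) (norm_nonneg (g (circleMap 0 r (-θ))))
    rw [mul_comm]
    gcongr
    · exact hr.1.le
    · nlinarith [sq_nonneg (‖g (circleMap 0 r θ)‖ - ‖g (circleMap 0 r (-θ))‖)]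
  · have hc' : Continuous fun θ ↦ g (circleMap 0 r (-θ)) := hc.comp continuous_neg
    exact continuous_const.mul ((hc.norm.fun_pow 2).add (hc'.norm.fun_pow 2))

lemma lintegral_Ioo_ofReal_of_continuousOn {f : ℝ → ℝ} {a b : ℝ} (hab : a ≤ b)
    (hf : ContinuousOn f (Icc a b)) (h0 : ∀ x, 0 ≤ f x) :
    ∫⁻ x in Ioo a b, ENNReal.ofReal (f x) = ENNReal.ofReal (∫ x in a..b, f x) := by
  rw [intervalIntegral.integral_of_le hab, ← restrict_Ioo_eq_restrict_Ioc]
  refine (ofReal_integral_eq_lintegral_ofReal ?_ (.of_forall h0)).symm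
  exact (hf.integrableOn_Icc).mono_set Ioo_subset_Icc_self

open Real in
lemma fejer_riesz {g : ℂ → ℂ} (hg : DifferentiableOn ℂ g unitDisc) {r : ℝ}
    (hr : r ∈ Ioo (0 : ℝ) 1) :
    ∫⁻ s in Ioo 0 r, ENNReal.ofReal (‖g s‖ ^ 2)
      ≤ ENNReal.ofReal r *
        ∫⁻ θ in Ioo (-π) π, ENNReal.ofReal (‖g (circleMap 0 r θ)‖ ^ 2) := by
  have hc : Continuous fun θ ↦ g (circleMap 0 r θ) := continuous_comp_circleMap hg.continuousOn hr
  have hmem : MapsTo (fun s : ℝ ↦ (s : ℂ)) (Icc (-r) r) unitDisc := fun s hs ↦ by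
    simp only [unitDisc, Metric.mem_ball, dist_zero_right, Complex.norm_real, Real.norm_eq_abs]
    exact lt_of_le_of_lt (abs_le.2 hs) hr.2
  have hcs : ContinuousOn (fun s : ℝ ↦ ‖g s‖ ^ 2) (Icc (-r) r) :=
    ((hg.continuousOn.comp (by fun_prop) hmem).norm).pow 2
  calc ∫⁻ s in Ioo 0 r, ENNReal.ofReal (‖g s‖ ^ 2)
      ≤ ∫⁻ s in Ioo (-r) r, ENNReal.ofReal (‖g s‖ ^ 2) :=
        lintegral_mono_set (Ioo_subset_Ioo_left (by linarith [hr.1]))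
    _ = ENNReal.ofReal (∫ s in -r..r, ‖g s‖ ^ 2) :=
        lintegral_Ioo_ofReal_of_continuousOn (by linarith [hr.1]) hcs fun _ ↦ by positivity
    _ ≤ ENNReal.ofReal (r * ∫ θ in -π..π, ‖g (circleMap 0 r θ)‖ ^ 2) :=
        ENNReal.ofReal_le_ofReal (intervalIntegral_norm_sq_le hg hr)
    _ = _ := by
        rw [ENNReal.ofReal_mul hr.1.le, lintegral_Ioo_ofReal_of_continuousOn (by linarith [pi_pos])
          (hc.norm.fun_pow 2).continuousOn fun _ ↦ by positivity]

open Real in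
/-- The mean of the Poisson kernel over a circle is `1`. -/
lemma integral_inv_norm_one_sub_sq {ρ : ℝ} (hρ0 : 0 ≤ ρ) (hρ1 : ρ < 1) :
    ∫ θ in -π..π, (1 - ρ ^ 2) / ‖1 - ρ * circleMap 0 1 θ‖ ^ 2 = 2 * π := by
  have hρ : ‖(ρ : ℂ)‖ = ρ := by simp [abs_of_nonneg hρ0]
  have key := DiffContOnCl.circleAverage_poissonKernel_smul' (f := fun _ ↦ (1 : ℂ)) (R := 1)
    (c := 0) (w := (ρ : ℂ)) diffContOnCl_const (by simpa [abs_of_nonneg hρ0])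
  have hnorm : ∀ θ, ‖circleMap 0 1 θ - ρ‖ = ‖1 - ρ * circleMap 0 1 θ‖ := fun θ ↦ by
    have e : circleMap 0 1 θ - ρ = circleMap 0 1 θ * (starRingEnd ℂ) (1 - ρ * circleMap 0 1 θ) := by
      rw [map_sub, map_mul, map_one, Complex.conj_ofReal, mul_sub, mul_left_comm, Complex.mul_conj,
        Complex.normSq_eq_norm_sq]
      simp
    rw [e, norm_mul, RCLike.norm_conj]
    simp
  have hper : Function.Periodic (fun θ ↦ (1 - ρ ^ 2) / ‖1 - ρ * circleMap 0 1 θ‖ ^ 2) (2 * π) :=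
    fun θ ↦ by simp only [periodic_circleMap 0 1 θ]
  have hshift := hper.intervalIntegral_add_eq (-π) 0
  rw [show -π + 2 * π = π by ring, zero_add] at hshift
  rw [hshift]
  simp only [Real.circleAverage, sub_zero, norm_circleMap_zero, abs_one, one_pow, hnorm, hρ,
    Complex.real_smul, mul_one, intervalIntegral.integral_ofReal] at key
  rw [← Complex.ofReal_mul, Complex.ofReal_eq_one] at key
  field_simp at key
  linarith

open Real in
lemma lintegral_inv_norm_one_sub_pow_four_le {ρ : ℝ} (hρ0 : 0 ≤ ρ) (hρ1 : ρ < 1) :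
    ∫⁻ θ in Ioo (-π) π, ENNReal.ofReal (1 / ‖1 - ρ * circleMap 0 1 θ‖ ^ 4)
      ≤ ENNReal.ofReal (2 * π / (1 - ρ) ^ 3) := by
  have hlow : ∀ θ, 1 - ρ ≤ ‖1 - ρ * circleMap 0 1 θ‖ := fun θ ↦ by
    have := norm_sub_norm_le (1 : ℂ) (ρ * circleMap 0 1 θ)
    simpa [abs_of_nonneg hρ0] using this
  have hpos : ∀ θ, 0 < ‖1 - ρ * circleMap 0 1 θ‖ := fun θ ↦ by linarith [hlow θ]
  have hcont : Continuous fun θ ↦ 1 - (ρ : ℂ) * circleMap 0 1 θ := by fun_prop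
  have hc4 : Continuous fun θ ↦ 1 / ‖1 - (ρ : ℂ) * circleMap 0 1 θ‖ ^ 4 :=
    continuous_const.div (hcont.norm.pow 4) fun θ ↦ (pow_pos (hpos θ) 4).ne'
  have hc2 : Continuous fun θ ↦ (1 - ρ ^ 2) / ‖1 - (ρ : ℂ) * circleMap 0 1 θ‖ ^ 2 :=
    continuous_const.div (hcont.norm.fun_pow 2) fun θ ↦ (pow_pos (hpos θ) 2).ne'
  rw [lintegral_Ioo_ofReal_of_continuousOn (by linarith [pi_pos]) hc4.continuousOn
    fun _ ↦ by positivity]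
  refine ENNReal.ofReal_le_ofReal ?_
  have h1 : 0 < 1 - ρ := by linarith
  calc ∫ θ in -π..π, 1 / ‖1 - (ρ : ℂ) * circleMap 0 1 θ‖ ^ 4
      ≤ ∫ θ in -π..π, 1 / (1 - ρ) ^ 3 * ((1 - ρ ^ 2) / ‖1 - (ρ : ℂ) * circleMap 0 1 θ‖ ^ 2) := by
        refine intervalIntegral.integral_mono_on (by linarith [pi_pos])
          (hc4.intervalIntegrable _ _) ((hc2.const_mul _).intervalIntegrable _ _) fun θ _ ↦ ?_
        have hd := hpos θ
        have hl := hlow θ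
        set d := ‖1 - (ρ : ℂ) * circleMap 0 1 θ‖
        rw [← mul_div_assoc, one_div_mul_eq_div, div_div, div_le_div_iff₀ (by positivity)
          (by positivity), one_mul]
        have h2 : (1 - ρ) ^ 2 ≤ d ^ 2 := by gcongr
        have h3 : 1 - ρ ≤ 1 - ρ ^ 2 := by nlinarith
        have h4 : 0 ≤ 1 - ρ ^ 2 := h1.le.trans h3
        calc (1 - ρ) ^ 3 * d ^ 2 = (1 - ρ) * ((1 - ρ) ^ 2 * d ^ 2) := by ring
          _ ≤ (1 - ρ ^ 2) * (d ^ 2 * d ^ 2) := by gcongr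
          _ = _ := by ring
    _ = 2 * π / (1 - ρ) ^ 3 := by
        rw [intervalIntegral.integral_const_mul, integral_inv_norm_one_sub_sq hρ0 hρ1]
        ring

/-! ### Radial weights in polar coordinates -/

open Real in
lemma setLIntegral_unitDisc (G : ℂ → ℝ≥0∞) :
    ∫⁻ z in unitDisc, G z
      = ∫⁻ p in Ioo (0 : ℝ) 1 ×ˢ Ioo (-π) π, ENNReal.ofReal p.1 * G (circleMap 0 p.1 p.2) := by
  have hd : MeasurableSet unitDisc := Metric.isOpen_ball.measurableSet
  have hr : MeasurableSet (Ioo (0 : ℝ) 1 ×ˢ Ioo (-π) π) := measurableSet_Ioo.prod measurableSet_Ioo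
  rw [← lintegral_indicator hd, ← Complex.lintegral_comp_polarCoord_symm, ← lintegral_indicator hr,
    ← lintegral_indicator polarCoord.open_target.measurableSet]
  congr 1
  ext p
  have hp : Complex.polarCoord.symm p = circleMap 0 p.1 p.2 := by
    simp [circleMap, Complex.exp_mul_I]
  have hu : circleMap 0 p.1 p.2 ∈ unitDisc ↔ |p.1| < 1 := by simp [unitDisc]
  by_cases h0 : 0 < p.1
  · rw [abs_of_pos h0] at hu
    have hind : unitDisc.indicator G (circleMap 0 p.1 p.2)
        = if p.1 < 1 then G (circleMap 0 p.1 p.2) else 0 := by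
      by_cases h1 : p.1 < 1
      · rw [indicator_of_mem (hu.2 h1), if_pos h1]
      · rw [indicator_of_notMem (mt hu.1 h1), if_neg h1]
    classical
    rw [indicator_apply, hp, hind, indicator_apply]
    by_cases h1 : p.1 < 1 <;> simp [h0, h1]
  · simp [h0]

lemma continuous_circleMap_uncurry : Continuous fun p : ℝ × ℝ ↦ circleMap 0 p.1 p.2 := by
  unfold circleMap
  fun_prop

open Real in
lemma ae_prod_of_ae_unitDisc {P : ℂ → Prop} (h : ∀ᵐ z ∂(volume.restrict unitDisc), P z) :
    ∀ᵐ p ∂((volume.restrict (Ioo (0 : ℝ) 1)).prod (volume.restrict (Ioo (-π) π))),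
      P (circleMap 0 p.1 p.2) := by
  set N := toMeasurable (volume.restrict unitDisc) {z | ¬ P z} with hN
  have hNm : MeasurableSet N := measurableSet_toMeasurable _ _
  have hN0 : ∫⁻ z in unitDisc, N.indicator 1 z = 0 := by
    rw [lintegral_indicator_one hNm, hN, measure_toMeasurable]
    exact h
  rw [setLIntegral_unitDisc, lintegral_eq_zero_iff] at hN0
  · rw [Measure.prod_restrict, ← Measure.volume_eq_prod]
    have hr : MeasurableSet (Ioo (0 : ℝ) 1 ×ˢ Ioo (-π) π) :=
      measurableSet_Ioo.prod measurableSet_Ioo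
    filter_upwards [hN0, ae_restrict_mem hr] with p hp hpr
    by_contra hcon
    have : circleMap 0 p.1 p.2 ∈ N := subset_toMeasurable _ _ hcon
    simp only [Pi.zero_apply, mul_eq_zero, ENNReal.ofReal_eq_zero, this, indicator_of_mem,
      Pi.one_apply, one_ne_zero, or_false] at hp
    exact absurd hpr.1.1 (not_lt.2 hp)
  · exact (ENNReal.measurable_ofReal.comp measurable_fst).mul
      ((measurable_one.indicator hNm).comp continuous_circleMap_uncurry.measurable)

lemma normalizedArea_restrict (s : Set ℂ) :
    normalizedArea.restrict s = (ENNReal.ofReal Real.pi)⁻¹ • volume.restrict s := by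
  rw [normalizedArea, Measure.restrict_smul]

lemma IsRadialWeight.apply_circleMap {v : ℂ → ℝ} (hv : IsRadialWeight v) {r : ℝ}
    (hr : r ∈ Ioo (0 : ℝ) 1) (θ : ℝ) : v (circleMap 0 r θ) = v r := by
  rw [hv.radial _ (circleMap_mem_unitDisc hr θ), norm_circleMap_zero, abs_of_pos hr.1]

/-- By Fubini's theorem in polar coordinates, a radial weight agrees on almost every radius with a
measurable function; by radiality, all radii carry the same profile. -/
lemma IsRadialWeight.aemeasurable {v : ℂ → ℝ} (hv : IsRadialWeight v) :
    AEMeasurable (fun s : ℝ ↦ v s) (volume.restrict (Ioo (0 : ℝ) 1)) := by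
  have h1 : AEMeasurable v (volume.restrict unitDisc) := by
    have := hv.integrable.aemeasurable
    rw [normalizedArea_restrict, aemeasurable_smul_measure_iff] at this
    · exact this
    · simp
  obtain ⟨g, hg, hvg⟩ := h1
  have h2 := Measure.ae_ae_of_ae_prod
    (Measure.measurePreserving_swap.quasiMeasurePreserving.ae (ae_prod_of_ae_unitDisc hvg))
  have : NeZero (volume.restrict (Ioo (-Real.pi) Real.pi)) := ⟨by
    simp [Measure.restrict_eq_zero, Real.pi_pos]⟩
  obtain ⟨θ, hθ⟩ := h2.exists
  refine ⟨fun r ↦ g (circleMap 0 r θ), hg.comp (by unfold circleMap; fun_prop), ?_⟩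
  filter_upwards [hθ, ae_restrict_mem measurableSet_Ioo] with r hr hr'
  rw [← hv.apply_circleMap hr' θ]
  exact hr

/-- A measurable version of the radial profile `s ↦ v s` of a radial weight. -/
structure IsProfile (v : ℂ → ℝ) (p : ℝ → ℝ≥0∞) : Prop where
  measurable : Measurable p
  ae_eq : (fun s : ℝ ↦ ENNReal.ofReal (v s)) =ᵐ[volume.restrict (Ioo (0 : ℝ) 1)] p

lemma IsRadialWeight.exists_isProfile {v : ℂ → ℝ} (hv : IsRadialWeight v) :
    ∃ p, IsProfile v p := by
  obtain ⟨p, hp, h⟩ := hv.aemeasurable.ennreal_ofReal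
  exact ⟨p, hp, h⟩

open Real in
lemma setLIntegral_unitDisc_eq_of_ae {G : ℂ → ℝ≥0∞} {φ : ℝ → ℝ≥0∞} {ψ : ℂ → ℝ≥0∞}
    (hφ : Measurable φ) (hψ : Measurable ψ)
    (h : ∀ᵐ r ∂(volume.restrict (Ioo (0 : ℝ) 1)),
      ∀ θ, G (circleMap 0 r θ) = φ r * ψ (circleMap 0 r θ)) :
    ∫⁻ z in unitDisc, G z
      = ∫⁻ r in Ioo (0 : ℝ) 1, ENNReal.ofReal r * φ r *
        ∫⁻ θ in Ioo (-π) π, ψ (circleMap 0 r θ) := by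
  rw [setLIntegral_unitDisc, Measure.volume_eq_prod, ← Measure.prod_restrict]
  have hm : Measurable fun q : ℝ × ℝ ↦ ENNReal.ofReal q.1 * φ q.1 :=
    measurable_fst.ennreal_ofReal.fun_mul (hφ.comp measurable_fst)
  have hψ' : Measurable fun q : ℝ × ℝ ↦ ψ (circleMap 0 q.1 q.2) :=
    hψ.comp continuous_circleMap_uncurry.measurable
  have hm' : Measurable fun q : ℝ × ℝ ↦
      ENNReal.ofReal q.1 * φ q.1 * ψ (circleMap 0 q.1 q.2) := hm.fun_mul hψ'
  have hfst := (Measure.quasiMeasurePreserving_fst (μ := volume.restrict (Ioo (0 : ℝ) 1))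
    (ν := volume.restrict (Ioo (-π) π))).ae h
  calc _ = ∫⁻ q, ENNReal.ofReal q.1 * φ q.1 * ψ (circleMap 0 q.1 q.2)
        ∂((volume.restrict (Ioo (0 : ℝ) 1)).prod (volume.restrict (Ioo (-π) π))) := by
        refine lintegral_congr_ae ?_
        filter_upwards [hfst] with q hq
        rw [hq, mul_assoc]
    _ = _ := by
        rw [lintegral_prod _ hm'.aemeasurable]
        refine lintegral_congr fun r ↦ ?_
        have hr : Measurable fun θ ↦ ψ (circleMap 0 r θ) :=
          hψ'.comp (measurable_prodMk_left (x := r))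
        exact lintegral_const_mul (ENNReal.ofReal r * φ r) hr

open Real in
/-- The area integral of `|D|² v` in polar coordinates. -/
lemma IsProfile.lintegral_normalizedArea {v : ℂ → ℝ} {p : ℝ → ℝ≥0∞} (hp : IsProfile v p)
    (hv : IsRadialWeight v) {D : ℂ → ℂ} (hD : Measurable D) :
    ∫⁻ z in unitDisc, ENNReal.ofReal (‖D z‖ ^ 2 * v z) ∂normalizedArea
      = (ENNReal.ofReal π)⁻¹ * ∫⁻ r in Ioo (0 : ℝ) 1, ENNReal.ofReal r * p r *
        ∫⁻ θ in Ioo (-π) π, ENNReal.ofReal (‖D (circleMap 0 r θ)‖ ^ 2) := by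
  rw [normalizedArea_restrict, lintegral_smul_measure, smul_eq_mul]
  congr 1
  refine setLIntegral_unitDisc_eq_of_ae (ψ := fun z ↦ ENNReal.ofReal (‖D z‖ ^ 2)) hp.measurable
    (hD.norm.pow_const 2).ennreal_ofReal ?_
  filter_upwards [hp.ae_eq, ae_restrict_mem measurableSet_Ioo] with r hr hr' θ
  rw [hv.apply_circleMap hr', ENNReal.ofReal_mul (by positivity), hr, mul_comm]

lemma IsProfile.tailIntegral_eq {v : ℂ → ℝ} {p : ℝ → ℝ≥0∞} (hp : IsProfile v p) {s : ℝ}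
    (hs : 0 ≤ s) : tailIntegral v s = ∫⁻ t in Ioo s 1, p t :=
  lintegral_congr_ae (ae_restrict_of_ae_restrict_of_subset (Ioo_subset_Ioo_left hs) hp.ae_eq)

lemma IsProfile.lintegral_lt_top {v : ℂ → ℝ} {p : ℝ → ℝ≥0∞} (hp : IsProfile v p)
    (hv : IsRadialWeight v) : ∫⁻ r in Ioo (0 : ℝ) 1, ENNReal.ofReal r * p r < ∞ := by
  have h := hp.lintegral_normalizedArea hv (D := fun _ ↦ 1) measurable_const
  have h1 : ∫⁻ z in unitDisc, ENNReal.ofReal (‖(1 : ℂ)‖ ^ 2 * v z) ∂normalizedArea < ∞ := by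
    simpa using hv.integrable.lintegral_lt_top
  rw [h] at h1
  have h2 : ∫⁻ θ in Ioo (-Real.pi) Real.pi, ENNReal.ofReal (‖(1 : ℂ)‖ ^ 2)
      = ENNReal.ofReal (2 * Real.pi) := by
    simp [two_mul]
  rw [h2, lintegral_mul_const _ ((ENNReal.measurable_ofReal).fun_mul hp.measurable)] at h1
  have h3 := ENNReal.lt_top_of_mul_ne_top_right h1.ne (by simp)
  exact ENNReal.lt_top_of_mul_ne_top_left h3.ne (by simp [Real.pi_pos])

lemma antitone_tailIntegral (v : ℂ → ℝ) : Antitone (tailIntegral v) := fun _ _ hab ↦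
  lintegral_mono_set (Ioo_subset_Ioo_left hab)

lemma measurable_tailIntegral (v : ℂ → ℝ) : Measurable (tailIntegral v) :=
  (antitone_tailIntegral v).measurable

/-- Measurability of the profile matters here: the lower integral of a positive nonmeasurable
function can vanish. -/
lemma IsRadialWeight.tailIntegral_pos {v : ℂ → ℝ} (hv : IsRadialWeight v) {s : ℝ}
    (hs : s ∈ Ioo (0 : ℝ) 1) : 0 < tailIntegral v s := by
  obtain ⟨p, hp⟩ := hv.exists_isProfile
  rw [hp.tailIntegral_eq hs.1.le, pos_iff_ne_zero, Ne, lintegral_eq_zero_iff hp.measurable]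
  intro h0
  have hsub := ae_restrict_of_ae_restrict_of_subset (Ioo_subset_Ioo_left hs.1.le) hp.ae_eq
  have : NeZero (volume.restrict (Ioo s 1)) := ⟨by
    simp [Measure.restrict_eq_zero, hs.2]⟩
  obtain ⟨t, ht0, ht1, ht⟩ := (h0.and (hsub.and (ae_restrict_mem measurableSet_Ioo))).exists
  have hmem : ((t : ℝ) : ℂ) ∈ unitDisc := by
    simpa [unitDisc, abs_of_pos (hs.1.trans ht.1)] using ht.2
  rw [ht0] at ht1
  exact absurd (hv.pos _ hmem) (not_lt.2 (by simpa using ht1))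

/-- Integrability over the disc controls `r v(r)` on the radius, so `s = 0` is excluded. -/
lemma IsRadialWeight.tailIntegral_ne_top {v : ℂ → ℝ} (hv : IsRadialWeight v) {s : ℝ}
    (hs : s ∈ Ioo (0 : ℝ) 1) : tailIntegral v s ≠ ∞ := by
  obtain ⟨p, hp⟩ := hv.exists_isProfile
  have h := hp.lintegral_lt_top hv
  have h1 : ENNReal.ofReal s * tailIntegral v s
      ≤ ∫⁻ r in Ioo (0 : ℝ) 1, ENNReal.ofReal r * p r := by
    rw [hp.tailIntegral_eq hs.1.le, ← lintegral_const_mul _ hp.measurable]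
    calc ∫⁻ t in Ioo s 1, ENNReal.ofReal s * p t ≤ ∫⁻ t in Ioo s 1, ENNReal.ofReal t * p t := by
          refine setLIntegral_mono' measurableSet_Ioo fun t ht ↦ ?_
          gcongr
          exact ht.1.le
      _ ≤ _ := lintegral_mono_set (Ioo_subset_Ioo_left hs.1.le)
  refine (ENNReal.lt_top_of_mul_ne_top_right (h1.trans_lt h).ne ?_).ne
  simpa using hs.1

lemma IsDoublingWeight.exists_le_mul {v : ℂ → ℝ} (hv : IsDoublingWeight v) :
    ∃ K : ℝ≥0, ∀ r ∈ Ioo (0 : ℝ) 1, tailIntegral v r ≤ K * tailIntegral v ((1 + r) / 2) := by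
  refine ⟨(⨆ r ∈ Ioo (0 : ℝ) 1, tailIntegral v r / tailIntegral v ((1 + r) / 2)).toNNReal,
    fun r hr ↦ ?_⟩
  have hr' : (1 + r) / 2 ∈ Ioo (0 : ℝ) 1 := ⟨by linarith [hr.1], by linarith [hr.2]⟩
  rw [ENNReal.coe_toNNReal hv.doubling.ne,
    ← ENNReal.div_le_iff (hv.isRadialWeight.tailIntegral_pos hr').ne'
      (hv.isRadialWeight.tailIntegral_ne_top hr')]
  exact le_iSup₂ (f := fun r _ ↦ tailIntegral v r / tailIntegral v ((1 + r) / 2)) r hr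

/-- The doubling condition extends the bound for `v̂(1/2)` to radii near `0`. -/
lemma IsDoublingWeight.exists_le {v : ℂ → ℝ} (hv : IsDoublingWeight v) :
    ∃ L : ℝ≥0, ∀ r ∈ Ioo (0 : ℝ) 1, tailIntegral v r ≤ L := by
  obtain ⟨K, hK⟩ := hv.exists_le_mul
  have h := hv.isRadialWeight.tailIntegral_ne_top (s := 1 / 2) ⟨by norm_num, by norm_num⟩
  refine ⟨K * (tailIntegral v (1 / 2)).toNNReal, fun r hr ↦ (hK r hr).trans ?_⟩
  rw [ENNReal.coe_mul, ENNReal.coe_toNNReal h]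
  gcongr
  exact antitone_tailIntegral v (by linarith [hr.1])

/-! ### Consequences of the Muckenhoupt-type conditions -/

lemma lintegral_Ioo_ne_zero {f : ℝ → ℝ≥0∞} (hf : Measurable f) {a b : ℝ} (hab : a < b)
    (h : ∀ x ∈ Ioo a b, f x ≠ 0) : ∫⁻ x in Ioo a b, f x ≠ 0 := by
  rw [← pos_iff_ne_zero, setLIntegral_pos_iff hf]
  have : Ioo a b ⊆ Function.support f ∩ Ioo a b := fun x hx ↦ ⟨h x hx, hx⟩
  exact lt_of_lt_of_le (by simp [hab]) (measure_mono this)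

lemma lintegral_Ioo_ne_top_of_le {f : ℝ → ℝ≥0∞} {a b : ℝ} {c : ℝ≥0∞} (hc : c ≠ ∞)
    (h : ∀ x ∈ Ioo a b, f x ≤ c) : ∫⁻ x in Ioo a b, f x ≠ ∞ := by
  refine ne_top_of_le_ne_top ?_ (setLIntegral_mono' measurableSet_Ioo h)
  simpa using ENNReal.mul_ne_top hc (by simp)

lemma lintegral_Ioo_ne_top_of_split {f : ℝ → ℝ≥0∞} {a b c : ℝ} (hab : a < b) (hbc : b < c)
    (h1 : ∫⁻ x in Ioo a b, f x ≠ ∞) (h2 : ∫⁻ x in Ioo b c, f x ≠ ∞) :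
    ∫⁻ x in Ioo a c, f x ≠ ∞ := by
  rw [restrict_Ioo_eq_restrict_Ioc] at h1 h2 ⊢
  rw [← Ioc_union_Ioc_eq_Ioc hab.le hbc.le]
  exact ne_top_of_le_ne_top (ENNReal.add_ne_top.2 ⟨h1, h2⟩) (lintegral_union_le _ _ _)

lemma ENNReal.mul_le_sq_of_rpow_half_mul_le {a b M : ℝ≥0∞}
    (h : a ^ (1 / 2 : ℝ) * b ^ (1 / 2 : ℝ) ≤ M) : a * b ≤ M ^ 2 := by
  rw [← ENNReal.mul_rpow_of_nonneg _ _ (by norm_num)] at h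
  calc a * b = ((a * b) ^ (1 / 2 : ℝ)) ^ 2 := by
        rw [← ENNReal.rpow_natCast, ← ENNReal.rpow_mul]; norm_num
    _ ≤ M ^ 2 := by gcongr

lemma measurable_ofReal_one_sub_pow (n : ℕ) :
    Measurable fun s : ℝ ↦ ENNReal.ofReal ((1 - s) ^ n) := by fun_prop

/-- The weight `v̂(s) / (1 - s)²`. The operators are controlled through the weighted `L²` norm
`∫ |f(s)|² v̂(s) / (1 - s)² ds` of the restriction of `f` to the radius `(0, 1)`. -/
noncomputable def radialWeight (v : ℂ → ℝ) (s : ℝ) : ℝ≥0∞ :=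
  tailIntegral v s / ENNReal.ofReal ((1 - s) ^ 2)

lemma measurable_radialWeight (v : ℂ → ℝ) : Measurable (radialWeight v) :=
  (measurable_tailIntegral v).div (measurable_ofReal_one_sub_pow 2)

section

variable {v : ℂ → ℝ}

lemma muckenhouptOne_bound (v : ℂ → ℝ) {r : ℝ} (hr : r ∈ Ioo (0 : ℝ) 1) :
    (∫⁻ s in Ioo r 1, radialWeight v s) * (∫⁻ s in Ioo 0 r, 1 / tailIntegral v s)
      ≤ muckenhouptOne v ^ 2 :=
  ENNReal.mul_le_sq_of_rpow_half_mul_le (le_iSup₂ (f := fun r (_ : r ∈ Ioo (0 : ℝ) 1) ↦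
    (∫⁻ s in Ioo r 1, tailIntegral v s / ENNReal.ofReal ((1 - s) ^ 2)) ^ (1 / 2 : ℝ) *
    (∫⁻ s in Ioo 0 r, 1 / tailIntegral v s) ^ (1 / 2 : ℝ)) r hr)

lemma muckenhouptTwo_bound (v : ℂ → ℝ) {r : ℝ} (hr : r ∈ Ioo (0 : ℝ) 1) :
    (∫⁻ s in Ioo 0 r, tailIntegral v s / ENNReal.ofReal ((1 - s) ^ 4)) *
      (∫⁻ s in Ioo r 1, ENNReal.ofReal ((1 - s) ^ 2) / tailIntegral v s)
      ≤ muckenhouptTwo v ^ 2 :=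
  ENNReal.mul_le_sq_of_rpow_half_mul_le (le_iSup₂ (f := fun r (_ : r ∈ Ioo (0 : ℝ) 1) ↦
    (∫⁻ s in Ioo 0 r, tailIntegral v s / ENNReal.ofReal ((1 - s) ^ 4)) ^ (1 / 2 : ℝ) *
    (∫⁻ s in Ioo r 1, ENNReal.ofReal ((1 - s) ^ 2) / tailIntegral v s) ^ (1 / 2 : ℝ)) r hr)

lemma ofReal_one_sub_pow_ne_zero {s : ℝ} (hs : s < 1) (n : ℕ) :
    ENNReal.ofReal ((1 - s) ^ n) ≠ 0 := by
  have : 0 < (1 - s) ^ n := pow_pos (by linarith) n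
  simpa using this

lemma IsRadialWeight.radialWeight_mul (hv : IsRadialWeight v) {s : ℝ} (hs : s ∈ Ioo (0 : ℝ) 1) :
    radialWeight v s * (ENNReal.ofReal ((1 - s) ^ 2) / tailIntegral v s) = 1 := by
  have h := ENNReal.div_ne_zero.2 ⟨(hv.tailIntegral_pos hs).ne',
    ENNReal.ofReal_ne_top (r := (1 - s) ^ 2)⟩
  have h' := ENNReal.div_ne_top (hv.tailIntegral_ne_top hs) (ofReal_one_sub_pow_ne_zero hs.2 2)
  rw [← ENNReal.inv_div (.inl (by simp)) (.inl (ofReal_one_sub_pow_ne_zero hs.2 2)), radialWeight,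
    ENNReal.mul_inv_cancel h h']

/-- Finiteness of the first Muckenhoupt-type quantity makes the first of its two factors finite,
since the second one does not vanish. -/
lemma IsDoublingWeight.lintegral_radialWeight_ne_top (hv : IsDoublingWeight v)
    (h1 : muckenhouptOne v < ∞) {r : ℝ} (hr : r ∈ Ioo (0 : ℝ) 1) :
    ∫⁻ s in Ioo r 1, radialWeight v s ≠ ∞ := by
  refine (ENNReal.lt_top_of_mul_ne_top_left
    (ne_top_of_le_ne_top (by finiteness) (muckenhouptOne_bound v hr)) ?_).ne
  refine lintegral_Ioo_ne_zero (by have := measurable_tailIntegral v; fun_prop) hr.1 fun s hs ↦ ?_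
  simpa using hv.isRadialWeight.tailIntegral_ne_top ⟨hs.1, hs.2.trans hr.2⟩

lemma IsDoublingWeight.lintegral_div_pow_ne_top (hv : IsDoublingWeight v) (n : ℕ) {r : ℝ}
    (hr : r ∈ Ioo (0 : ℝ) 1) :
    ∫⁻ s in Ioo 0 r, tailIntegral v s / ENNReal.ofReal ((1 - s) ^ n) ≠ ∞ := by
  obtain ⟨L, hL⟩ := hv.exists_le
  refine lintegral_Ioo_ne_top_of_le (c := L / ENNReal.ofReal ((1 - r) ^ n))
    (ENNReal.div_ne_top (by simp) (ofReal_one_sub_pow_ne_zero hr.2 n)) fun s hs ↦ ?_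
  have h1 : 0 ≤ 1 - r := by linarith [hr.2]
  gcongr
  · exact hL s ⟨hs.1, hs.2.trans hr.2⟩
  · exact hs.2.le

lemma IsDoublingWeight.lintegral_Ioo_radialWeight_ne_top (hv : IsDoublingWeight v)
    (h1 : muckenhouptOne v < ∞) : ∫⁻ s in Ioo (0 : ℝ) 1, radialWeight v s ≠ ∞ :=
  have hr : (1 / 2 : ℝ) ∈ Ioo (0 : ℝ) 1 := ⟨by norm_num, by norm_num⟩
  lintegral_Ioo_ne_top_of_split hr.1 hr.2 (hv.lintegral_div_pow_ne_top 2 hr)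
    (hv.lintegral_radialWeight_ne_top h1 hr)

lemma IsDoublingWeight.lintegral_sq_div_ne_top (hv : IsDoublingWeight v)
    (h2 : muckenhouptTwo v < ∞) :
    ∫⁻ s in Ioo (0 : ℝ) 1, ENNReal.ofReal ((1 - s) ^ 2) / tailIntegral v s ≠ ∞ := by
  have hr : (1 / 2 : ℝ) ∈ Ioo (0 : ℝ) 1 := ⟨by norm_num, by norm_num⟩
  refine lintegral_Ioo_ne_top_of_split hr.1 hr.2 ?_ ?_
  · refine lintegral_Ioo_ne_top_of_le (c := ENNReal.ofReal 1 / tailIntegral v (1 / 2))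
      (ENNReal.div_ne_top (by simp) (hv.isRadialWeight.tailIntegral_pos hr).ne') fun s hs ↦ ?_
    gcongr
    · exact pow_le_one₀ (by linarith [hs.2]) (by linarith [hs.1])
    · exact antitone_tailIntegral v hs.2.le
  · refine (ENNReal.lt_top_of_mul_ne_top_right
      (ne_top_of_le_ne_top (by finiteness) (muckenhouptTwo_bound v hr)) ?_).ne
    refine lintegral_Ioo_ne_zero
      ((measurable_tailIntegral v).div (measurable_ofReal_one_sub_pow 4)) hr.1 fun s hs ↦ ?_
    have := hv.isRadialWeight.tailIntegral_pos ⟨hs.1, hs.2.trans hr.2⟩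
    simpa using this.ne'

/-- `φ` is integrable over `(0, 1)` when its weighted `L²` norm is finite. -/
lemma IsDoublingWeight.exists_sq_lintegral_le (hv : IsDoublingWeight v)
    (h2 : muckenhouptTwo v < ∞) :
    ∃ C : ℝ≥0, ∀ φ : ℝ → ℝ≥0∞, Measurable φ →
      (∫⁻ t in Ioo (0 : ℝ) 1, φ t) ^ 2
        ≤ C * ∫⁻ t in Ioo (0 : ℝ) 1, φ t ^ 2 * radialWeight v t := by
  refine ⟨(∫⁻ s in Ioo (0 : ℝ) 1, ENNReal.ofReal ((1 - s) ^ 2) / tailIntegral v s).toNNReal,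
    fun φ hφ ↦ ?_⟩
  rw [ENNReal.coe_toNNReal (hv.lintegral_sq_div_ne_top h2), mul_comm]
  refine sq_lintegral_le_mul_lintegral
    ((hφ.pow_const 2).mul (measurable_radialWeight v)).aemeasurable
    ((measurable_ofReal_one_sub_pow 2).div (measurable_tailIntegral v)).aemeasurable ?_
  filter_upwards [ae_restrict_mem measurableSet_Ioo] with s hs
  rw [mul_assoc, hv.isRadialWeight.radialWeight_mul hs, mul_one]

/-- The function `(1 - t)^(-3/2)`. -/
noncomputable def growthFactor (t : ℝ) : ℝ≥0∞ := ENNReal.ofReal ((1 - t) * √(1 - t))⁻¹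

lemma measurable_growthFactor : Measurable growthFactor := by
  unfold growthFactor
  fun_prop

lemma growthFactor_sq {t : ℝ} (ht : t < 1) :
    growthFactor t ^ 2 = (ENNReal.ofReal ((1 - t) ^ 3))⁻¹ := by
  have h : 0 < 1 - t := by linarith
  rw [growthFactor, ← ENNReal.ofReal_pow (by positivity),
    ← ENNReal.ofReal_inv_of_pos (by positivity), inv_pow, mul_pow, Real.sq_sqrt h.le]
  congr 2

lemma growthFactor_ne_zero {t : ℝ} (ht : t < 1) : growthFactor t ≠ 0 := by
  have h : 0 < 1 - t := by linarith
  simp [growthFactor, h]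

lemma growthFactor_ne_top (t : ℝ) : growthFactor t ≠ ∞ := ENNReal.ofReal_ne_top

/-- On the dyadic interval `(r, (1 + r) / 2)` the integrand `v̂(s) / (1 - s)²` is at least
`v̂((1 + r) / 2) / (1 - r)²`, which is comparable to `v̂(r) / (1 - r)²`. -/
lemma IsDoublingWeight.exists_tailIntegral_le (hv : IsDoublingWeight v) :
    ∃ K : ℝ≥0, ∀ r ∈ Ioo (0 : ℝ) 1,
      tailIntegral v r ≤ K * (ENNReal.ofReal (1 - r) * ∫⁻ s in Ioo r 1, radialWeight v s) := by
  obtain ⟨K, hK⟩ := hv.exists_le_mul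
  refine ⟨K * 2, fun r hr ↦ (hK r hr).trans ?_⟩
  have h1 : 0 < 1 - r := by linarith [hr.2]
  have h2 : ENNReal.ofReal (1 - r) ≠ 0 := by simpa using h1
  have hlow : tailIntegral v ((1 + r) / 2) / ENNReal.ofReal ((1 - r) ^ 2)
      * ENNReal.ofReal ((1 - r) / 2) ≤ ∫⁻ s in Ioo r 1, radialWeight v s := by
    calc _ = ∫⁻ s in Ioo r ((1 + r) / 2),
          tailIntegral v ((1 + r) / 2) / ENNReal.ofReal ((1 - r) ^ 2) := by
          rw [lintegral_const, Measure.restrict_apply_univ, Real.volume_Ioo]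
          congr 2
          ring
      _ ≤ ∫⁻ s in Ioo r ((1 + r) / 2), radialWeight v s := by
          refine setLIntegral_mono' measurableSet_Ioo fun s hs ↦ ?_
          have : 0 ≤ 1 - s := by linarith [hs.2]
          unfold radialWeight
          gcongr
          · exact antitone_tailIntegral v hs.2.le
          · exact hs.1.le
      _ ≤ _ := lintegral_mono_set (Ioo_subset_Ioo_right (by linarith))
  have e : tailIntegral v ((1 + r) / 2) = 2 * (ENNReal.ofReal (1 - r) *
      (tailIntegral v ((1 + r) / 2) / ENNReal.ofReal ((1 - r) ^ 2)
      * ENNReal.ofReal ((1 - r) / 2))) := by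
    rw [ENNReal.ofReal_div_of_pos (by norm_num), ENNReal.ofReal_pow h1.le]
    have : 2 * (ENNReal.ofReal (1 - r) * (tailIntegral v ((1 + r) / 2) / ENNReal.ofReal (1 - r) ^ 2
        * (ENNReal.ofReal (1 - r) / ENNReal.ofReal 2)))
        = tailIntegral v ((1 + r) / 2) * (ENNReal.ofReal (1 - r) ^ 2 / ENNReal.ofReal (1 - r) ^ 2)
          * (2 / ENNReal.ofReal 2) := by
      simp only [div_eq_mul_inv]
      ring
    rw [this, ENNReal.div_self (pow_ne_zero 2 h2) (by finiteness), ENNReal.ofReal_ofNat,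
      ENNReal.div_self (by simp) (by simp), mul_one, mul_one]
  rw [e, ENNReal.coe_mul, mul_assoc]
  gcongr
  rw [ENNReal.coe_ofNat]

lemma IsProfile.lintegral_ofReal_mul_le {p : ℝ → ℝ≥0∞} (hp : IsProfile v p) {x : ℝ}
    (hx : 0 ≤ x) : ∫⁻ s in Ioo x 1, ENNReal.ofReal s * p s ≤ tailIntegral v x := by
  rw [hp.tailIntegral_eq hx]
  refine setLIntegral_mono' measurableSet_Ioo fun s hs ↦ ?_
  exact mul_le_of_le_one_left' (by simpa using hs.2.le)

/-- The part of the kernel over `t < s`: the Hardy inequality with weight `v̂(t) (1 - t)`. -/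
lemma IsDoublingWeight.exists_hardy_growth (hv : IsDoublingWeight v) (h1 : muckenhouptOne v < ∞)
    {p : ℝ → ℝ≥0∞} (hp : IsProfile v p) :
    ∃ C : ℝ≥0, ∀ φ : ℝ → ℝ≥0∞, Measurable φ →
      ∫⁻ s in Ioo (0 : ℝ) 1, ENNReal.ofReal s * p s * (∫⁻ t in Ioo 0 s, φ t * growthFactor t) ^ 2
        ≤ C * ∫⁻ t in Ioo (0 : ℝ) 1, φ t ^ 2 * radialWeight v t := by
  obtain ⟨K, hK⟩ := hv.exists_tailIntegral_le
  have hT := measurable_tailIntegral v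
  have hw : Measurable fun s : ℝ ↦ tailIntegral v s * ENNReal.ofReal (1 - s) := by fun_prop
  obtain ⟨C, hC⟩ := exists_hardy_left (u := fun s ↦ ENNReal.ofReal s * p s)
    (w := fun s ↦ tailIntegral v s * ENNReal.ofReal (1 - s))
    (q := fun s ↦ (tailIntegral v s * ENNReal.ofReal (1 - s))⁻¹)
    (ENNReal.measurable_ofReal.fun_mul hp.measurable) hw hw.inv
    (fun x hx ↦ by
      have hx1 : 0 < 1 - x := by linarith [hx.2]
      rw [ENNReal.mul_inv_cancel]
      · exact mul_ne_zero (hv.isRadialWeight.tailIntegral_pos hx).ne' (by simpa using hx1)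
      · exact ENNReal.mul_ne_top (hv.isRadialWeight.tailIntegral_ne_top hx) (by simp))
    (B := K * muckenhouptOne v ^ 2) (by finiteness)
    (fun x hx ↦ by
      have hx1 : 0 < 1 - x := by linarith [hx.2]
      have hx2 : ENNReal.ofReal (1 - x) ≠ 0 := by simpa using hx1
      have hq : ∫⁻ t in Ioo 0 x, (tailIntegral v t * ENNReal.ofReal (1 - t))⁻¹
          ≤ (ENNReal.ofReal (1 - x))⁻¹ * ∫⁻ t in Ioo 0 x, 1 / tailIntegral v t := by
        rw [← lintegral_const_mul' _ _ (by simpa using hx1)]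
        refine setLIntegral_mono' measurableSet_Ioo fun t ht ↦ ?_
        have htx : t ∈ Ioo (0 : ℝ) 1 := ⟨ht.1, ht.2.trans hx.2⟩
        rw [ENNReal.mul_inv (.inl (hv.isRadialWeight.tailIntegral_pos htx).ne')
          (.inl (hv.isRadialWeight.tailIntegral_ne_top htx)), mul_comm, one_div]
        gcongr
        exact ht.2.le
      calc _ ≤ K * (ENNReal.ofReal (1 - x) * ∫⁻ s in Ioo x 1, radialWeight v s) *
            ((ENNReal.ofReal (1 - x))⁻¹ * ∫⁻ t in Ioo 0 x, 1 / tailIntegral v t) := by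
            gcongr
            exact (hp.lintegral_ofReal_mul_le hx.1.le).trans (hK x hx)
        _ = K * ((ENNReal.ofReal (1 - x) * (ENNReal.ofReal (1 - x))⁻¹) *
            ((∫⁻ s in Ioo x 1, radialWeight v s) * ∫⁻ t in Ioo 0 x, 1 / tailIntegral v t)) := by
            ring
        _ ≤ _ := by
            rw [ENNReal.mul_inv_cancel hx2 (by simp), one_mul]
            gcongr
            exact muckenhouptOne_bound v hx)
    (fun x hx ↦ ne_top_of_le_ne_top (hv.isRadialWeight.tailIntegral_ne_top hx)
      (hp.lintegral_ofReal_mul_le hx.1.le))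
  refine ⟨C, fun φ hφ ↦ (hC _ (hφ.fun_mul measurable_growthFactor)).trans_eq ?_⟩
  congr 1
  refine setLIntegral_congr_fun measurableSet_Ioo fun t ht ↦ ?_
  have ht1 : 0 < 1 - t := by linarith [ht.2]
  have ht2 : ENNReal.ofReal (1 - t) ≠ 0 := by simpa using ht1
  rw [mul_pow, growthFactor_sq ht.2, radialWeight, ENNReal.ofReal_pow ht1.le,
    ENNReal.ofReal_pow ht1.le, pow_succ (ENNReal.ofReal (1 - t)) 2,
    ENNReal.mul_inv (.inr (by simp)) (.inr ht2), div_eq_mul_inv]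
  calc _ = φ t ^ 2 * (tailIntegral v t * (ENNReal.ofReal (1 - t) ^ 2)⁻¹) *
      (ENNReal.ofReal (1 - t) * (ENNReal.ofReal (1 - t))⁻¹) := by ring
    _ = _ := by rw [ENNReal.mul_inv_cancel ht2 (by simp), mul_one]

/-- An elementary substitute for `(1 - s)⁻³ = 1 + 3 ∫_0^s (1 - t)⁻⁴ dt`: for `s > 1/2`, integrate
over `(2 s - 1, s)`, where `1 - t ≤ 2 (1 - s)`. -/
lemma one_div_one_sub_pow_three_le {s : ℝ} (hs : s ∈ Ioo (0 : ℝ) 1) :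
    (ENNReal.ofReal ((1 - s) ^ 3))⁻¹
      ≤ 8 + 16 * ∫⁻ t in Ioo 0 s, (ENNReal.ofReal ((1 - t) ^ 4))⁻¹ := by
  have h1 : 0 < 1 - s := by linarith [hs.2]
  rcases le_or_gt s (1 / 2) with h | h
  · refine le_trans ?_ le_self_add
    rw [← ENNReal.ofReal_inv_of_pos (by positivity)]
    refine ENNReal.ofReal_le_of_le_toReal ?_
    rw [inv_le_comm₀ (by positivity) (by simp)]
    have h2 : (1 / 2 : ℝ) ^ 3 ≤ (1 - s) ^ 3 := by gcongr; linarith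
    norm_num at h2 ⊢
    linarith
  · refine le_trans ?_ le_add_self
    calc (ENNReal.ofReal ((1 - s) ^ 3))⁻¹
        = 16 * ∫⁻ t in Ioo (2 * s - 1) s, (ENNReal.ofReal ((2 * (1 - s)) ^ 4))⁻¹ := by
          rw [lintegral_const, Measure.restrict_apply_univ, Real.volume_Ioo,
            ← ENNReal.ofReal_inv_of_pos (by positivity),
            ← ENNReal.ofReal_inv_of_pos (by positivity),
            ← ENNReal.ofReal_mul (by positivity),
            show (16 : ℝ≥0∞) = ENNReal.ofReal 16 by simp, ← ENNReal.ofReal_mul (by positivity)]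
          congr 1
          have : s - (2 * s - 1) = 1 - s := by ring
          rw [this]
          field_simp
          norm_num
      _ ≤ 16 * ∫⁻ t in Ioo (2 * s - 1) s, (ENNReal.ofReal ((1 - t) ^ 4))⁻¹ := by
          gcongr 16 * ?_
          refine setLIntegral_mono' measurableSet_Ioo fun t ht ↦ ?_
          have : 0 ≤ 1 - t := by linarith [ht.2]
          gcongr
          linarith [ht.1]
      _ ≤ _ := by
          gcongr
          linarith

/-- Integration by parts, in the form of Tonelli's theorem, replaces `v(s) / (1 - s)³` by
`v̂(t) / (1 - t)⁴`, the integrand of the second Muckenhoupt-type quantity. -/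
lemma IsProfile.lintegral_div_one_sub_pow_three_le {p : ℝ → ℝ≥0∞} (hp : IsProfile v p) {x : ℝ}
    (hx : x ∈ Ioo (0 : ℝ) 1) :
    ∫⁻ s in Ioo 0 x, ENNReal.ofReal s * p s * (ENNReal.ofReal ((1 - s) ^ 3))⁻¹
      ≤ 8 * (∫⁻ s in Ioo (0 : ℝ) 1, ENNReal.ofReal s * p s)
        + 16 * ∫⁻ t in Ioo 0 x, tailIntegral v t / ENNReal.ofReal ((1 - t) ^ 4) := by
  set g : ℝ → ℝ≥0∞ := fun t ↦ (ENNReal.ofReal ((1 - t) ^ 4))⁻¹ with hg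
  have hgm : Measurable g := (measurable_ofReal_one_sub_pow 4).inv
  have hpm : Measurable fun s ↦ ENNReal.ofReal s * p s :=
    ENNReal.measurable_ofReal.fun_mul hp.measurable
  have hIm : Measurable fun s ↦ ENNReal.ofReal s * p s * (16 * ∫⁻ t in Ioo 0 s, g t) :=
    hpm.fun_mul ((measurable_lintegral_Ioo_left g).const_mul 16)
  set a : ℝ → ℝ≥0∞ := (Iio x).indicator p with ha
  have ham : Measurable a := hp.measurable.indicator measurableSet_Iio
  calc ∫⁻ s in Ioo 0 x, ENNReal.ofReal s * p s * (ENNReal.ofReal ((1 - s) ^ 3))⁻¹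
      ≤ ∫⁻ s in Ioo 0 x, (8 * (ENNReal.ofReal s * p s)
        + ENNReal.ofReal s * p s * (16 * ∫⁻ t in Ioo 0 s, g t)) := by
        refine setLIntegral_mono' measurableSet_Ioo fun s hs ↦ ?_
        rw [mul_comm 8, ← mul_add]
        gcongr
        exact one_div_one_sub_pow_three_le ⟨hs.1, hs.2.trans hx.2⟩
    _ = 8 * (∫⁻ s in Ioo 0 x, ENNReal.ofReal s * p s)
        + ∫⁻ s in Ioo 0 x, ENNReal.ofReal s * p s * (16 * ∫⁻ t in Ioo 0 s, g t) := by
        rw [lintegral_add_right _ hIm, lintegral_const_mul _ hpm]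
    _ ≤ _ := by
        gcongr ?_ + ?_
        · gcongr
          exact hx.2.le
        · calc _ ≤ ∫⁻ s in Ioo 0 x, 16 * (a s * ∫⁻ t in Ioo 0 s, g t) := by
                refine setLIntegral_mono' measurableSet_Ioo fun s hs ↦ ?_
                have : a s = p s := indicator_of_mem (mem_Iio.2 hs.2) _
                rw [this, mul_left_comm]
                gcongr
                exact mul_le_of_le_one_left' (by simpa using hs.2.le.trans hx.2.le)
            _ ≤ ∫⁻ s in Ioo (0 : ℝ) 1, 16 * (a s * ∫⁻ t in Ioo 0 s, g t) :=
                lintegral_mono_set (Ioo_subset_Ioo_right hx.2.le)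
            _ = 16 * ∫⁻ t in Ioo (0 : ℝ) 1, g t * ∫⁻ s in Ioo t 1, a s := by
                rw [lintegral_const_mul' _ _ (by simp), lintegral_Ioo_mul_lintegral_Ioo ham hgm]
            _ ≤ 16 * ∫⁻ t in Ioo (0 : ℝ) 1, (Iio x).indicator
                  (fun t ↦ tailIntegral v t / ENNReal.ofReal ((1 - t) ^ 4)) t := by
                gcongr 16 * ?_
                refine setLIntegral_mono' measurableSet_Ioo fun t ht ↦ ?_
                rcases lt_or_ge t x with h | h
                · rw [indicator_of_mem (mem_Iio.2 h), div_eq_mul_inv, mul_comm,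
                    hp.tailIntegral_eq ht.1.le]
                  gcongr with s
                  exact indicator_le_self _ _ s
                · have : ∫⁻ s in Ioo t 1, a s = 0 := by
                    rw [setLIntegral_congr_fun (g := fun _ ↦ 0) measurableSet_Ioo fun s hs ↦
                      indicator_of_notMem (by simpa using h.trans hs.1.le) _]
                    simp
                  simp [this]
            _ = _ := by
                rw [lintegral_indicator measurableSet_Iio,
                  Measure.restrict_restrict measurableSet_Iio]
                congr 3
                ext t
                simp only [mem_inter_iff, mem_Iio, mem_Ioo]
                grind [hx.2]

/-- The part of the kernel over `t > s`: the Hardy inequality given by the second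
Muckenhoupt-type condition. -/
lemma IsDoublingWeight.exists_hardy_tail (hv : IsDoublingWeight v) (h2 : muckenhouptTwo v < ∞)
    {p : ℝ → ℝ≥0∞} (hp : IsProfile v p) :
    ∃ C : ℝ≥0, ∀ φ : ℝ → ℝ≥0∞, Measurable φ →
      ∫⁻ s in Ioo (0 : ℝ) 1, ENNReal.ofReal s * p s * (growthFactor s * ∫⁻ t in Ioo s 1, φ t) ^ 2
        ≤ C * ∫⁻ t in Ioo (0 : ℝ) 1, φ t ^ 2 * radialWeight v t := by
  set m := ∫⁻ s in Ioo (0 : ℝ) 1, ENNReal.ofReal s * p s with hm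
  set Q := ∫⁻ s in Ioo (0 : ℝ) 1, ENNReal.ofReal ((1 - s) ^ 2) / tailIntegral v s with hQ
  have hmt : m ≠ ∞ := (hp.lintegral_lt_top hv.isRadialWeight).ne
  have hQt : Q ≠ ∞ := hv.lintegral_sq_div_ne_top h2
  have hT := measurable_tailIntegral v
  obtain ⟨C, hC⟩ := exists_hardy_right
    (u := fun s ↦ ENNReal.ofReal s * p s * (ENNReal.ofReal ((1 - s) ^ 3))⁻¹)
    (w := radialWeight v) (q := fun s ↦ ENNReal.ofReal ((1 - s) ^ 2) / tailIntegral v s)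
    ((ENNReal.measurable_ofReal.fun_mul hp.measurable).fun_mul
      (measurable_ofReal_one_sub_pow 3).inv)
    (measurable_radialWeight v) ((measurable_ofReal_one_sub_pow 2).div hT)
    (fun x hx ↦ (hv.isRadialWeight.radialWeight_mul hx).ge)
    (B := 8 * m * Q + 16 * muckenhouptTwo v ^ 2) (by finiteness)
    (fun x hx ↦ by
      calc _ ≤ (8 * m + 16 * ∫⁻ t in Ioo 0 x, tailIntegral v t / ENNReal.ofReal ((1 - t) ^ 4)) *
            ∫⁻ s in Ioo x 1, ENNReal.ofReal ((1 - s) ^ 2) / tailIntegral v s := by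
            gcongr
            exact hp.lintegral_div_one_sub_pow_three_le hx
        _ ≤ _ := by
            rw [add_mul, mul_assoc 16]
            gcongr
            · exact lintegral_mono_set (Ioo_subset_Ioo_left hx.1.le)
            · exact muckenhouptTwo_bound v hx)
    (fun x hx ↦ ne_top_of_le_ne_top
      (ENNReal.add_ne_top.2 ⟨ENNReal.mul_ne_top (by simp) hmt,
        ENNReal.mul_ne_top (by simp) (hv.lintegral_div_pow_ne_top 4 hx)⟩)
      (hp.lintegral_div_one_sub_pow_three_le hx))
  refine ⟨C, fun φ hφ ↦ Eq.trans_le ?_ (hC φ hφ)⟩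
  refine setLIntegral_congr_fun measurableSet_Ioo fun s hs ↦ ?_
  rw [mul_pow, growthFactor_sq hs.2]
  ring

end

/-! ### Square means of the kernel `|1 - t z|⁻²` -/

/-- A form of Minkowski's integral inequality for square means, obtained from the Cauchy–Schwarz
inequality with weight `c`, where `c(t)` is comparable to the square mean of `k(·, t)`. -/
lemma lintegral_sq_lintegral_mul_le {α β : Type*} [MeasurableSpace α] [MeasurableSpace β]
    {μ : Measure α} {ν : Measure β} [SFinite μ] [SFinite ν] {φ c : α → ℝ≥0∞} {k : β → α → ℝ≥0∞}
    (hφ : Measurable φ) (hc : Measurable c) (hk : Measurable (Function.uncurry k)) {M : ℝ≥0∞}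
    (hc0 : ∀ᵐ t ∂μ, c t ≠ 0) (hct : ∀ᵐ t ∂μ, c t ≠ ∞)
    (h : ∀ᵐ t ∂μ, ∫⁻ θ, k θ t ^ 2 ∂ν ≤ M * c t ^ 2) :
    ∫⁻ θ, (∫⁻ t, φ t * k θ t ∂μ) ^ 2 ∂ν ≤ M * (∫⁻ t, φ t * c t ∂μ) ^ 2 := by
  have hφc : Measurable fun t ↦ φ t * (c t)⁻¹ := hφ.fun_mul hc.inv
  have hb : Measurable (Function.uncurry fun (θ : β) (t : α) ↦ φ t * (c t)⁻¹ * k θ t ^ 2) :=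
    (hφc.comp measurable_snd).fun_mul (hk.pow_const 2)
  have hkt : ∀ θ, Measurable fun t ↦ k θ t := fun θ ↦ hk.comp (measurable_prodMk_left (x := θ))
  have hkθ : ∀ t, Measurable fun θ ↦ k θ t := fun t ↦ hk.comp (measurable_prodMk_right (y := t))
  set N := ∫⁻ t, φ t * c t ∂μ with hN
  calc ∫⁻ θ, (∫⁻ t, φ t * k θ t ∂μ) ^ 2 ∂ν
      ≤ ∫⁻ θ, N * ∫⁻ t, φ t * (c t)⁻¹ * k θ t ^ 2 ∂μ ∂ν := by
        gcongr with θ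
        refine sq_lintegral_le_mul_lintegral (hφ.mul hc).aemeasurable
          (hφc.mul ((hkt θ).pow_const 2)).aemeasurable ?_
        filter_upwards [hc0, hct] with t h0 ht
        refine le_of_eq ?_
        calc (φ t * k θ t) ^ 2 = (c t * (c t)⁻¹) * (φ t * k θ t) ^ 2 := by
              rw [ENNReal.mul_inv_cancel h0 ht, one_mul]
          _ = _ := by ring
    _ = N * ∫⁻ t, ∫⁻ θ, φ t * (c t)⁻¹ * k θ t ^ 2 ∂ν ∂μ := by
        rw [lintegral_const_mul _ hb.lintegral_prod_right, lintegral_lintegral_swap hb.aemeasurable]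
    _ ≤ N * ∫⁻ t, M * (φ t * c t) ∂μ := by
        gcongr N * ?_
        refine lintegral_mono_ae ?_
        filter_upwards [hc0, hct, h] with t h0 ht hM
        rw [lintegral_const_mul _ ((hkθ t).pow_const 2)]
        calc φ t * (c t)⁻¹ * ∫⁻ θ, k θ t ^ 2 ∂ν ≤ φ t * (c t)⁻¹ * (M * c t ^ 2) := by gcongr
          _ = M * (φ t * c t) * (c t * (c t)⁻¹) := by ring
          _ = _ := by rw [ENNReal.mul_inv_cancel h0 ht, mul_one]
    _ = _ := by
        rw [lintegral_const_mul _ (hφ.fun_mul hc)]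
        ring

/-- The kernel `|1 - t z|⁻²`, which dominates the derivative of `1 / (1 - t z)` in `z`. -/
noncomputable def sqKernel (t : ℝ) (z : ℂ) : ℝ≥0∞ := ENNReal.ofReal (1 / ‖1 - t * z‖ ^ 2)

lemma measurable_sqKernel (r : ℝ) :
    Measurable fun q : ℝ × ℝ ↦ sqKernel q.2 (circleMap 0 r q.1) := by
  unfold sqKernel circleMap
  fun_prop

open Real in
lemma lintegral_sqKernel_sq_le {t r : ℝ} (ht : t ∈ Ioo (0 : ℝ) 1) (hr : r ∈ Ioo (0 : ℝ) 1) :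
    ∫⁻ θ in Ioo (-π) π, sqKernel t (circleMap 0 r θ) ^ 2
      ≤ ENNReal.ofReal (2 * π) * (ENNReal.ofReal ((1 - t * r) ^ 3))⁻¹ := by
  have h0 : 0 ≤ t * r := mul_nonneg ht.1.le hr.1.le
  have h1 : t * r < 1 := by nlinarith [ht.1, ht.2, hr.1, hr.2]
  have h2 : 0 < 1 - t * r := by linarith
  have key := lintegral_inv_norm_one_sub_pow_four_le h0 h1
  rw [div_eq_mul_inv, ENNReal.ofReal_mul (by positivity),
    ENNReal.ofReal_inv_of_pos (by positivity)] at key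
  refine le_trans (le_of_eq ?_) key
  refine lintegral_congr fun θ ↦ ?_
  have e : (t : ℂ) * circleMap 0 r θ = (t * r : ℝ) * circleMap 0 1 θ := by
    simp [circleMap, mul_assoc]
  rw [sqKernel, e, ← ENNReal.ofReal_pow (by positivity), div_pow, one_pow, ← pow_mul]

open Real in
lemma lintegral_sq_lintegral_sqKernel_le {φ c : ℝ → ℝ≥0∞} (hφ : Measurable φ) (hc : Measurable c)
    {S : Set ℝ} (hS : MeasurableSet S) (hS1 : S ⊆ Ioo 0 1) {r : ℝ} (hr : r ∈ Ioo (0 : ℝ) 1)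
    (hc0 : ∀ t ∈ S, c t ≠ 0) (hct : ∀ t ∈ S, c t ≠ ∞)
    (h : ∀ t ∈ S, (ENNReal.ofReal ((1 - t * r) ^ 3))⁻¹ ≤ c t ^ 2) :
    ∫⁻ θ in Ioo (-π) π, (∫⁻ t in S, φ t * sqKernel t (circleMap 0 r θ)) ^ 2
      ≤ ENNReal.ofReal (2 * π) * (∫⁻ t in S, φ t * c t) ^ 2 := by
  refine lintegral_sq_lintegral_mul_le (k := fun θ t ↦ sqKernel t (circleMap 0 r θ)) hφ hc
    (measurable_sqKernel r) ((ae_restrict_iff' hS).2 (.of_forall hc0))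
    ((ae_restrict_iff' hS).2 (.of_forall hct)) ?_
  filter_upwards [ae_restrict_mem hS] with t ht
  refine (lintegral_sqKernel_sq_le (hS1 ht) hr).trans ?_
  gcongr
  exact h t ht

open Real in
/-- The square mean over `|z| = r`, split at `t = r`: the factor `1 - t r` is at least `1 - t`, used
for `t < r`, and at least `1 - r`, used for `t > r`. -/
lemma lintegral_sq_lintegral_Ioo_le {φ : ℝ → ℝ≥0∞} (hφ : Measurable φ) {r : ℝ}
    (hr : r ∈ Ioo (0 : ℝ) 1) :
    ∫⁻ θ in Ioo (-π) π, (∫⁻ t in Ioo (0 : ℝ) 1, φ t * sqKernel t (circleMap 0 r θ)) ^ 2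
      ≤ ENNReal.ofReal (4 * π) * ((∫⁻ t in Ioo 0 r, φ t * growthFactor t) ^ 2
        + (growthFactor r * ∫⁻ t in Ioo r 1, φ t) ^ 2) := by
  have hk := measurable_sqKernel r
  have hm : Measurable fun q : ℝ × ℝ ↦ φ q.2 * sqKernel q.2 (circleMap 0 r q.1) :=
    (hφ.comp measurable_snd).fun_mul hk
  have hbound : ∀ s t : ℝ, 0 ≤ 1 - s → 1 - s ≤ 1 - t * r → s < 1 →
      (ENNReal.ofReal ((1 - t * r) ^ 3))⁻¹ ≤ growthFactor s ^ 2 := fun s t h0 h hs ↦ by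
    rw [growthFactor_sq hs]
    gcongr
  have hI := lintegral_sq_lintegral_sqKernel_le hφ measurable_growthFactor
    (measurableSet_Ioo (a := 0) (b := r)) (Ioo_subset_Ioo_right hr.2.le) hr
    (fun t ht ↦ growthFactor_ne_zero (ht.2.trans hr.2)) (fun t _ ↦ growthFactor_ne_top t)
    (fun t ht ↦ hbound t t (by linarith [ht.2, hr.2]) (by nlinarith [ht.1, hr.2])
      (ht.2.trans hr.2))
  have hII := lintegral_sq_lintegral_sqKernel_le hφ (measurable_const (a := growthFactor r))
    (measurableSet_Ioo (a := r) (b := 1)) (Ioo_subset_Ioo_left hr.1.le) hr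
    (fun t _ ↦ growthFactor_ne_zero hr.2) (fun t _ ↦ growthFactor_ne_top r)
    (fun t ht ↦ hbound r t (by linarith [hr.2]) (by nlinarith [ht.2, hr.1]) hr.2)
  rw [lintegral_mul_const _ hφ, mul_comm _ (growthFactor r)] at hII
  have hmI : Measurable fun θ ↦ (∫⁻ t in Ioo 0 r, φ t * sqKernel t (circleMap 0 r θ)) ^ 2 :=
    (hm.lintegral_prod_right').pow_const 2
  have hmII : Measurable fun θ ↦ (∫⁻ t in Ioo r 1, φ t * sqKernel t (circleMap 0 r θ)) ^ 2 :=
    (hm.lintegral_prod_right').pow_const 2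
  calc _ ≤ ∫⁻ θ in Ioo (-π) π, (2 * (∫⁻ t in Ioo 0 r, φ t * sqKernel t (circleMap 0 r θ)) ^ 2
        + 2 * (∫⁻ t in Ioo r 1, φ t * sqKernel t (circleMap 0 r θ)) ^ 2) := by
        gcongr with θ
        refine le_trans ?_ (ENNReal.add_sq_le _ _)
        gcongr
        simp only [restrict_Ioo_eq_restrict_Ioc]
        rw [← Ioc_union_Ioc_eq_Ioc hr.1.le hr.2.le]
        exact lintegral_union_le _ _ _
    _ = 2 * (∫⁻ θ in Ioo (-π) π, (∫⁻ t in Ioo 0 r, φ t * sqKernel t (circleMap 0 r θ)) ^ 2)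
        + 2 * ∫⁻ θ in Ioo (-π) π, (∫⁻ t in Ioo r 1, φ t * sqKernel t (circleMap 0 r θ)) ^ 2 := by
        rw [lintegral_add_left (hmI.const_mul 2), lintegral_const_mul _ hmI,
          lintegral_const_mul _ hmII]
    _ ≤ _ := by
        have e : ENNReal.ofReal (4 * π) = 2 * ENNReal.ofReal (2 * π) := by
          rw [show 4 * π = 2 * (2 * π) by ring, ENNReal.ofReal_mul (by norm_num),
            ENNReal.ofReal_ofNat]
        refine (add_le_add (mul_le_mul_right hI 2) (mul_le_mul_right hII 2)).trans_eq ?_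
        rw [e]
        ring

section

variable {v : ℂ → ℝ}

open Real in
lemma IsDoublingWeight.exists_kernel_bound (hv : IsDoublingWeight v) (h1 : muckenhouptOne v < ∞)
    (h2 : muckenhouptTwo v < ∞) {p : ℝ → ℝ≥0∞} (hp : IsProfile v p) :
    ∃ C : ℝ≥0, ∀ φ : ℝ → ℝ≥0∞, Measurable φ →
      ∫⁻ r in Ioo (0 : ℝ) 1, ENNReal.ofReal r * p r *
          ∫⁻ θ in Ioo (-π) π, (∫⁻ t in Ioo (0 : ℝ) 1, φ t * sqKernel t (circleMap 0 r θ)) ^ 2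
        ≤ C * ∫⁻ t in Ioo (0 : ℝ) 1, φ t ^ 2 * radialWeight v t := by
  obtain ⟨C₁, hC₁⟩ := hv.exists_hardy_growth h1 hp
  obtain ⟨C₂, hC₂⟩ := hv.exists_hardy_tail h2 hp
  refine ⟨(4 * π).toNNReal * (C₁ + C₂), fun φ hφ ↦ ?_⟩
  have hm : Measurable fun r ↦ ENNReal.ofReal r * p r *
      (∫⁻ t in Ioo 0 r, φ t * growthFactor t) ^ 2 :=
    (ENNReal.measurable_ofReal.fun_mul hp.measurable).fun_mul
      ((measurable_lintegral_Ioo_left _).pow_const 2)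
  calc _ ≤ ∫⁻ r in Ioo (0 : ℝ) 1, ENNReal.ofReal (4 * π) * (ENNReal.ofReal r * p r *
          (∫⁻ t in Ioo 0 r, φ t * growthFactor t) ^ 2 + ENNReal.ofReal r * p r *
          (growthFactor r * ∫⁻ t in Ioo r 1, φ t) ^ 2) := by
        refine setLIntegral_mono' measurableSet_Ioo fun r hr ↦ ?_
        rw [← mul_add, mul_left_comm]
        gcongr
        exact lintegral_sq_lintegral_Ioo_le hφ hr
    _ ≤ ENNReal.ofReal (4 * π) * (C₁ * (∫⁻ t in Ioo (0 : ℝ) 1, φ t ^ 2 * radialWeight v t)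
          + C₂ * ∫⁻ t in Ioo (0 : ℝ) 1, φ t ^ 2 * radialWeight v t) := by
        rw [lintegral_const_mul' _ _ ENNReal.ofReal_ne_top, lintegral_add_left hm]
        gcongr
        · exact hC₁ φ hφ
        · exact hC₂ φ hφ
    _ = _ := by
        rw [ENNReal.coe_mul, ENNReal.coe_add, ENNReal.ofReal]
        ring

end

/-! ### Restriction of functions in `D_v` to the radius -/

section

variable {v : ℂ → ℝ}

lemma ofReal_norm_sq_eq_enorm_sq (z : ℂ) : ENNReal.ofReal (‖z‖ ^ 2) = ‖z‖ₑ ^ 2 := by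
  rw [ENNReal.ofReal_pow (norm_nonneg z), ofReal_norm]

lemma dirichletNorm_sq (v : ℂ → ℝ) (f : ℂ → ℂ) :
    dirichletNorm v f ^ 2 = ENNReal.ofReal (‖f 0‖ ^ 2) +
      ∫⁻ z in unitDisc, ENNReal.ofReal (‖deriv f z‖ ^ 2 * v z) ∂normalizedArea := by
  rw [dirichletNorm, ← ENNReal.rpow_natCast, ← ENNReal.rpow_mul]
  norm_num

lemma ofReal_mem_unitDisc {s : ℝ} (hs : s ∈ Ico (0 : ℝ) 1) : (s : ℂ) ∈ unitDisc := by
  simpa [unitDisc, abs_of_nonneg hs.1] using hs.2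

lemma measurable_deriv_ofReal (f : ℂ → ℂ) : Measurable fun s : ℝ ↦ deriv f s :=
  (measurable_deriv f).comp Complex.measurable_ofReal

open Real in
/-- The Fejér–Riesz inequality integrated against `v`. -/
lemma IsRadialWeight.lintegral_tailIntegral_le (hv : IsRadialWeight v) {f : ℂ → ℂ}
    (hf : DifferentiableOn ℂ f unitDisc) :
    ∫⁻ s in Ioo (0 : ℝ) 1, ‖deriv f s‖ₑ ^ 2 * tailIntegral v s
      ≤ ENNReal.ofReal π * dirichletNorm v f ^ 2 := by
  obtain ⟨p, hp⟩ := hv.exists_isProfile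
  have hm : Measurable fun s : ℝ ↦ ‖deriv f s‖ₑ ^ 2 :=
    (measurable_deriv_ofReal f).enorm.pow_const 2
  calc _ = ∫⁻ s in Ioo (0 : ℝ) 1, ‖deriv f s‖ₑ ^ 2 * ∫⁻ t in Ioo s 1, p t :=
        setLIntegral_congr_fun measurableSet_Ioo fun s hs ↦ by rw [hp.tailIntegral_eq hs.1.le]
    _ = ∫⁻ r in Ioo (0 : ℝ) 1, p r * ∫⁻ s in Ioo 0 r, ‖deriv f s‖ₑ ^ 2 :=
        (lintegral_Ioo_mul_lintegral_Ioo hp.measurable hm).symm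
    _ ≤ ∫⁻ r in Ioo (0 : ℝ) 1, ENNReal.ofReal r * p r *
          ∫⁻ θ in Ioo (-π) π, ENNReal.ofReal (‖deriv f (circleMap 0 r θ)‖ ^ 2) := by
        refine setLIntegral_mono' measurableSet_Ioo fun r hr ↦ ?_
        rw [mul_comm (ENNReal.ofReal r), mul_assoc]
        gcongr
        simp_rw [← ofReal_norm_sq_eq_enorm_sq]
        exact fejer_riesz (hf.deriv Metric.isOpen_ball) hr
    _ = ENNReal.ofReal π * ∫⁻ z in unitDisc, ENNReal.ofReal (‖deriv f z‖ ^ 2 * v z)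
          ∂normalizedArea := by
        rw [hp.lintegral_normalizedArea hv (measurable_deriv f), ← mul_assoc,
          ENNReal.mul_inv_cancel (by simp [pi_pos]) (by simp), one_mul]
    _ ≤ _ := by
        rw [dirichletNorm_sq]
        gcongr
        exact le_add_self

lemma enorm_le_add_lintegral_deriv {f : ℂ → ℂ} (hf : DifferentiableOn ℂ f unitDisc) {t : ℝ}
    (ht : t ∈ Ioo (0 : ℝ) 1) : ‖f t‖ₑ ≤ ‖f 0‖ₑ + ∫⁻ s in Ioo 0 t, ‖deriv f s‖ₑ := by
  have hmem : ∀ s ∈ uIcc 0 t, ((s : ℝ) : ℂ) ∈ unitDisc := fun s hs ↦ by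
    rw [uIcc_of_le ht.1.le] at hs
    exact ofReal_mem_unitDisc ⟨hs.1, hs.2.trans_lt ht.2⟩
  have hd : ContinuousOn (fun s : ℝ ↦ deriv f s) (uIcc 0 t) :=
    (hf.deriv Metric.isOpen_ball).continuousOn.comp (by fun_prop) hmem
  have key := intervalIntegral.integral_eq_sub_of_hasDerivAt (f := fun s : ℝ ↦ f s)
    (f' := fun s : ℝ ↦ deriv f s) (a := 0) (b := t)
    (fun s hs ↦ ((hf.differentiableAt
      (Metric.isOpen_ball.mem_nhds (hmem s hs))).hasDerivAt).comp_ofReal)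
    hd.intervalIntegrable
  have e : f t = f 0 + ∫ s in (0 : ℝ)..t, deriv f s := by
    rw [key]
    simp
  rw [e]
  refine (enorm_add_le _ _).trans ?_
  gcongr
  rw [intervalIntegral.integral_of_le ht.1.le, ← restrict_Ioo_eq_restrict_Ioc]
  exact enorm_integral_le_lintegral_enorm _

/-- The weighted Hardy inequality given by the first Muckenhoupt-type condition bounds the
weighted `L²` norm of `f` on the radius by the norm of `f` in `D_v`. -/
lemma IsDoublingWeight.exists_radial_bound (hv : IsDoublingWeight v) (h1 : muckenhouptOne v < ∞) :
    ∃ C : ℝ≥0, ∀ f : ℂ → ℂ, DifferentiableOn ℂ f unitDisc →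
      ∫⁻ t in Ioo (0 : ℝ) 1, ‖f t‖ₑ ^ 2 * radialWeight v t ≤ C * dirichletNorm v f ^ 2 := by
  have hT := measurable_tailIntegral v
  have hR := measurable_radialWeight v
  obtain ⟨C, hC⟩ := exists_hardy_left (q := fun s ↦ 1 / tailIntegral v s) hR hT (by fun_prop)
    (fun x hx ↦ by
      rw [one_div, ENNReal.mul_inv_cancel (hv.isRadialWeight.tailIntegral_pos hx).ne'
        (hv.isRadialWeight.tailIntegral_ne_top hx)])
    (B := muckenhouptOne v ^ 2) (by finiteness) (fun x hx ↦ muckenhouptOne_bound v hx)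
    (fun x hx ↦ hv.lintegral_radialWeight_ne_top h1 hx)
  set m := ∫⁻ s in Ioo (0 : ℝ) 1, radialWeight v s with hm
  have hmt : m ≠ ∞ := hv.lintegral_Ioo_radialWeight_ne_top h1
  refine ⟨2 * m.toNNReal + 2 * C * Real.pi.toNNReal, fun f hf ↦ ?_⟩
  have hd := (measurable_deriv_ofReal f).enorm
  calc _ ≤ ∫⁻ t in Ioo (0 : ℝ) 1, (2 * ‖f 0‖ₑ ^ 2 * radialWeight v t +
          2 * (radialWeight v t * (∫⁻ s in Ioo 0 t, ‖deriv f s‖ₑ) ^ 2)) := by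
        refine setLIntegral_mono' measurableSet_Ioo fun t ht ↦ ?_
        calc ‖f t‖ₑ ^ 2 * radialWeight v t
            ≤ (2 * ‖f 0‖ₑ ^ 2 + 2 * (∫⁻ s in Ioo 0 t, ‖deriv f s‖ₑ) ^ 2) * radialWeight v t := by
              gcongr
              refine le_trans ?_ (ENNReal.add_sq_le _ _)
              gcongr
              exact enorm_le_add_lintegral_deriv hf ht
          _ = _ := by ring
    _ = 2 * ‖f 0‖ₑ ^ 2 * m + 2 * ∫⁻ t in Ioo (0 : ℝ) 1,
          radialWeight v t * (∫⁻ s in Ioo 0 t, ‖deriv f s‖ₑ) ^ 2 := by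
        rw [lintegral_add_left (hR.const_mul _), lintegral_const_mul _ hR,
          lintegral_const_mul' _ _ (by simp)]
    _ ≤ 2 * dirichletNorm v f ^ 2 * m
          + 2 * (C * (ENNReal.ofReal Real.pi * dirichletNorm v f ^ 2)) := by
        gcongr 2 * ?_ * m + 2 * ?_
        · rw [dirichletNorm_sq, ← ofReal_norm_sq_eq_enorm_sq]
          exact le_self_add
        · refine (hC _ hd).trans ?_
          gcongr
          exact hv.isRadialWeight.lintegral_tailIntegral_le hf
    _ = _ := by
        push_cast
        rw [ENNReal.coe_toNNReal hmt, ENNReal.ofReal]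
        ring

/-! ### Integrals of Cauchy type along the radius -/

lemma norm_one_sub_mul_ge {t : ℝ} (ht : t ∈ Icc (0 : ℝ) 1) (z : ℂ) :
    1 - ‖z‖ ≤ ‖1 - t * z‖ := by
  have h := norm_sub_norm_le (1 : ℂ) (t * z)
  have h' : ‖(t : ℂ) * z‖ ≤ ‖z‖ := by
    rw [norm_mul, Complex.norm_real, Real.norm_of_nonneg ht.1]
    exact mul_le_of_le_one_left (norm_nonneg z) ht.2
  rw [norm_one] at h
  linarith

lemma one_sub_mul_ne_zero {t : ℝ} (ht : t ∈ Icc (0 : ℝ) 1) {z : ℂ} (hz : z ∈ unitDisc) :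
    1 - t * z ≠ 0 := by
  have hz' : ‖z‖ < 1 := by simpa [unitDisc] using hz
  exact norm_pos_iff.1 (by linarith [norm_one_sub_mul_ge ht z])

lemma intervalIntegrable_div_one_sub_mul {h : ℝ → ℂ} (hh : IntervalIntegrable h volume 0 1)
    {z : ℂ} (hz : z ∈ unitDisc) :
    IntervalIntegrable (fun t : ℝ ↦ h t / (1 - t * z)) volume 0 1 := by
  simp_rw [div_eq_mul_inv]
  refine hh.mul_continuousOn (ContinuousOn.inv₀ (by fun_prop) fun t ht ↦ ?_)
  rw [uIcc_of_le zero_le_one] at ht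
  exact one_sub_mul_ne_zero ht hz

lemma hasDerivAt_integral_div_one_sub_mul {h : ℝ → ℂ} (hh : IntervalIntegrable h volume 0 1)
    {z : ℂ} (hz : z ∈ unitDisc) :
    HasDerivAt (fun w : ℂ ↦ ∫ t in (0 : ℝ)..1, h t / (1 - t * w))
      (∫ t in (0 : ℝ)..1, h t * (t / (1 - t * z) ^ 2)) z := by
  have hz' : ‖z‖ < 1 := by simpa [unitDisc] using hz
  set ε := (1 - ‖z‖) / 2 with hε
  have hε0 : 0 < ε := by rw [hε]; linarith
  have hball : ∀ w ∈ Metric.ball z ε, ε ≤ 1 - ‖w‖ := fun w hw ↦ by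
    have h1 : ‖w - z‖ < ε := by simpa [dist_eq_norm] using hw
    have h2 := norm_sub_norm_le w z
    linarith
  have hmem : ∀ w ∈ Metric.ball z ε, w ∈ unitDisc := fun w hw ↦ by
    have := hball w hw
    simp only [unitDisc, Metric.mem_ball, dist_zero_right]
    linarith
  have hIcc : ∀ t : ℝ, t ∈ uIoc (0 : ℝ) 1 → t ∈ Icc (0 : ℝ) 1 := fun t ht ↦ by
    rw [uIoc_of_le zero_le_one] at ht
    exact Ioc_subset_Icc_self ht
  refine (intervalIntegral.hasDerivAt_integral_of_dominated_loc_of_deriv_le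
    (F := fun (w : ℂ) (t : ℝ) ↦ h t / (1 - t * w))
    (F' := fun (w : ℂ) (t : ℝ) ↦ h t * (t / (1 - t * w) ^ 2))
    (bound := fun t ↦ ‖h t‖ * (1 / ε ^ 2)) (Metric.ball_mem_nhds z hε0) ?_
    (intervalIntegrable_div_one_sub_mul hh hz) ?_ ?_ (hh.norm.mul_const _) ?_).2
  · filter_upwards [Metric.ball_mem_nhds z hε0] with w hw
    exact (intervalIntegrable_div_one_sub_mul hh (hmem w hw)).def'.aestronglyMeasurable
  · refine (hh.mul_continuousOn ?_).def'.aestronglyMeasurable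
    refine ContinuousOn.div (by fun_prop) (by fun_prop) fun t ht ↦ ?_
    rw [uIcc_of_le zero_le_one] at ht
    exact pow_ne_zero 2 (one_sub_mul_ne_zero ht hz)
  · refine .of_forall fun t ht w hw ↦ ?_
    have ht' := hIcc t ht
    have h1 : ε ≤ ‖1 - t * w‖ := (hball w hw).trans (norm_one_sub_mul_ge ht' w)
    rw [norm_mul, norm_div, norm_pow, Complex.norm_real, Real.norm_of_nonneg ht'.1]
    gcongr
    exact ht'.2
  · refine .of_forall fun t ht w hw ↦ ?_
    have h0 := one_sub_mul_ne_zero (hIcc t ht) (hmem w hw)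
    have h1 : HasDerivAt (fun w : ℂ ↦ 1 - t * w) (-(t : ℂ)) w := by
      simpa using ((hasDerivAt_id w).const_mul (t : ℂ)).const_sub 1
    have h2 := (h1.inv h0).const_mul (h t)
    simpa [div_eq_mul_inv] using h2

lemma enorm_integral_le_lintegral_sqKernel {h : ℝ → ℂ} (z : ℂ) :
    ‖∫ t in (0 : ℝ)..1, h t * (t / (1 - t * z) ^ 2)‖ₑ
      ≤ ∫⁻ t in Ioo (0 : ℝ) 1, ‖h t‖ₑ * sqKernel t z := by
  rw [intervalIntegral.integral_of_le zero_le_one, ← restrict_Ioo_eq_restrict_Ioc]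
  refine (enorm_integral_le_lintegral_enorm _).trans ?_
  refine setLIntegral_mono' measurableSet_Ioo fun t ht ↦ ?_
  rw [enorm_mul]
  gcongr
  rw [sqKernel, ← ofReal_norm, norm_div, norm_pow, Complex.norm_real,
    Real.norm_of_nonneg ht.1.le]
  gcongr
  exact ht.2.le

open Real in
/-- Integrals of Cauchy type whose density has the modulus of `f` on the radius are bounded by
the norm of `f` in `D_v`. -/
lemma IsDoublingWeight.exists_cauchy_bound (hv : IsDoublingWeight v) (h1 : muckenhouptOne v < ∞)
    (h2 : muckenhouptTwo v < ∞) :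
    ∃ C : ℝ≥0, ∀ f : ℂ → ℂ, MemDirichlet v f → ∀ h : ℝ → ℂ,
      AEStronglyMeasurable h (volume.restrict (Ioo (0 : ℝ) 1)) →
      (∀ t ∈ Ioo (0 : ℝ) 1, ‖h t‖ = ‖f t‖) → ∀ F : ℂ → ℂ,
      (∀ z ∈ unitDisc, F z = ∫ t in (0 : ℝ)..1, h t / (1 - t * z)) →
      IntervalIntegrable h volume 0 1 ∧ MemDirichlet v F ∧
        dirichletNorm v F ≤ C * dirichletNorm v f := by
  obtain ⟨p, hp⟩ := hv.isRadialWeight.exists_isProfile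
  obtain ⟨C₀, hC₀⟩ := hv.exists_radial_bound h1
  obtain ⟨C₁, hC₁⟩ := hv.exists_sq_lintegral_le h2
  obtain ⟨C₂, hC₂⟩ := hv.exists_kernel_bound h1 h2 hp
  set C : ℝ≥0 := (C₁ + C₂) * C₀ with hCdef
  refine ⟨C + 1, fun f hf h hhm hhf F hF ↦ ?_⟩
  set φ : ℝ → ℝ≥0∞ := (Ioo (0 : ℝ) 1).indicator fun t ↦ ‖f t‖ₑ with hφ
  have hfc : ContinuousOn (fun t : ℝ ↦ f t) (Ioo 0 1) :=
    hf.analytic.continuousOn.comp (by fun_prop) fun t ht ↦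
      ofReal_mem_unitDisc (Ioo_subset_Ico_self ht)
  have hφm : Measurable φ := by
    have := hfc.enorm.measurable_piecewise (continuousOn_const (c := (0 : ℝ≥0∞))) measurableSet_Ioo
    rw [hφ, ← piecewise_eq_indicator]
    exact this
  have hφh : ∀ t ∈ Ioo (0 : ℝ) 1, ‖h t‖ₑ = φ t := fun t ht ↦ by
    rw [hφ, indicator_of_mem ht, ← ofReal_norm, hhf t ht, ofReal_norm]
  set A := ∫⁻ t in Ioo (0 : ℝ) 1, φ t ^ 2 * radialWeight v t with hA
  have hAf : A ≤ C₀ * dirichletNorm v f ^ 2 := by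
    refine (setLIntegral_congr_fun measurableSet_Ioo fun t ht ↦ ?_).trans_le (hC₀ f hf.analytic)
    rw [hφ, indicator_of_mem ht]
  have hD : dirichletNorm v f ≠ ∞ := hf.norm_lt_top.ne
  have hint : ∫⁻ t in Ioo (0 : ℝ) 1, ‖h t‖ₑ = ∫⁻ t in Ioo (0 : ℝ) 1, φ t :=
    setLIntegral_congr_fun measurableSet_Ioo hφh
  have hφA : (∫⁻ t in Ioo (0 : ℝ) 1, φ t) ^ 2 ≤ C₁ * A := hC₁ φ hφm
  have hh : IntervalIntegrable h volume 0 1 := by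
    rw [intervalIntegrable_iff_integrableOn_Ioo_of_le zero_le_one]
    refine ⟨hhm, ?_⟩
    rw [hasFiniteIntegral_iff_enorm, hint]
    have hA' : A ≠ ∞ := ne_top_of_le_ne_top (by finiteness) hAf
    have : (∫⁻ t in Ioo (0 : ℝ) 1, φ t) ^ 2 ≠ ∞ := ne_top_of_le_ne_top (by finiteness) hφA
    rw [lt_top_iff_ne_top]
    intro htop
    simp [htop] at this
  have hderiv : ∀ z ∈ unitDisc, HasDerivAt F (∫ t in (0 : ℝ)..1, h t * (t / (1 - t * z) ^ 2)) z :=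
    fun z hz ↦ (hasDerivAt_integral_div_one_sub_mul hh hz).congr_of_eventuallyEq
      (Filter.eventuallyEq_of_mem (Metric.isOpen_ball.mem_nhds hz) hF)
  have h0 : ENNReal.ofReal (‖F 0‖ ^ 2) ≤ C₁ * A := by
    refine le_trans ?_ hφA
    rw [ofReal_norm_sq_eq_enorm_sq, hF 0 (by simp [unitDisc]), ← hint,
      intervalIntegral.integral_of_le zero_le_one, ← restrict_Ioo_eq_restrict_Ioc]
    gcongr
    simpa using enorm_integral_le_lintegral_enorm (μ := volume.restrict (Ioo (0 : ℝ) 1)) h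
  have hmain : ∫⁻ z in unitDisc, ENNReal.ofReal (‖deriv F z‖ ^ 2 * v z) ∂normalizedArea
      ≤ C₂ * A := by
    rw [hp.lintegral_normalizedArea hv.isRadialWeight (measurable_deriv F)]
    have hπ : (ENNReal.ofReal π)⁻¹ ≤ 1 := by
      rw [ENNReal.inv_le_one, ENNReal.one_le_ofReal]
      linarith [pi_gt_three]
    refine (mul_le_of_le_one_left' hπ).trans (le_trans ?_ (hC₂ φ hφm))
    refine setLIntegral_mono' measurableSet_Ioo fun r hr ↦ ?_
    gcongr with θ
    rw [ofReal_norm_sq_eq_enorm_sq, (hderiv _ (circleMap_mem_unitDisc hr θ)).deriv]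
    gcongr
    refine (enorm_integral_le_lintegral_sqKernel _).trans_eq ?_
    exact setLIntegral_congr_fun measurableSet_Ioo fun t ht ↦ by rw [hφh t ht]
  have hsq : dirichletNorm v F ^ 2 ≤ (((C + 1 : ℝ≥0) : ℝ≥0∞) * dirichletNorm v f) ^ 2 := by
    have hC1 : C ≤ (C + 1) ^ 2 := by nlinarith [zero_le (a := C)]
    calc dirichletNorm v F ^ 2 ≤ C₁ * A + C₂ * A := by
          rw [dirichletNorm_sq]
          gcongr
      _ ≤ (C₁ + C₂) * (C₀ * dirichletNorm v f ^ 2) := by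
          rw [← add_mul]
          gcongr
      _ = (C : ℝ≥0∞) * dirichletNorm v f ^ 2 := by
          rw [hCdef]
          push_cast
          ring
      _ ≤ (((C + 1) ^ 2 : ℝ≥0) : ℝ≥0∞) * dirichletNorm v f ^ 2 := by
          gcongr
      _ = _ := by
          rw [mul_pow, ENNReal.coe_pow]
  have hle : dirichletNorm v F ≤ ((C + 1 : ℝ≥0) : ℝ≥0∞) * dirichletNorm v f :=
    (ENNReal.pow_le_pow_left_iff two_ne_zero).1 hsq
  exact ⟨hh, ⟨fun z hz ↦ (hderiv z hz).differentiableAt.differentiableWithinAt,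
    hle.trans_lt (by finiteness)⟩, hle⟩

/-! ### The Hilbert operators -/

lemma deriv_hilbertSymbol {z : ℂ} (hz : z ∈ unitDisc) : deriv hilbertSymbol z = 1 / (1 - z) := by
  have hz' : ‖z‖ < 1 := by simpa [unitDisc] using hz
  have hre : 0 < (1 - z).re := by
    have := (Complex.re_le_norm z).trans_lt hz'
    simpa using this
  have hne : 1 - z ≠ 0 := fun h ↦ by simp [h] at hre
  have h1 : HasDerivAt (fun w : ℂ ↦ 1 / (1 - w)) (1 / (1 - z) ^ 2) z := by
    have h2 : HasDerivAt (fun w : ℂ ↦ 1 - w) (-1) z := (hasDerivAt_id z).const_sub 1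
    simpa [one_div] using h2.fun_inv hne
  have hs : 1 / (1 - z) ∈ Complex.slitPlane := by
    refine .inl ?_
    rw [one_div, Complex.inv_re]
    exact div_pos hre (Complex.normSq_pos.2 hne)
  have h3 := h1.clog hs
  have : HasDerivAt hilbertSymbol (1 / (1 - z) ^ 2 / (1 / (1 - z))) z := h3
  rw [this.deriv]
  field_simp

lemma generalizedHilbertIntegrand_hilbertSymbol (f : ℂ → ℂ) {z : ℂ} (hz : z ∈ unitDisc) {t : ℝ}
    (ht : t ∈ Icc (0 : ℝ) 1) :
    generalizedHilbertIntegrand hilbertSymbol f z t = f t / (1 - t * z) := by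
  have hz' : ‖z‖ < 1 := by simpa [unitDisc] using hz
  have : (t : ℂ) * z ∈ unitDisc := by
    simp only [unitDisc, Metric.mem_ball, dist_zero_right, norm_mul, Complex.norm_real,
      Real.norm_of_nonneg ht.1]
    exact (mul_le_of_le_one_left (norm_nonneg z) ht.2).trans_lt hz'
  rw [generalizedHilbertIntegrand, deriv_hilbertSymbol this, mul_one_div]

end

/-- For a doubling weight with finite Muckenhoupt-type quantities, the integrals defining the
Hilbert operator and the sublinear Hilbert operator converge absolutely on `D_v`, and both
operators are bounded on `D_v`. -/
theorem corollary3 (v : ℂ → ℝ) (hv : IsDoublingWeight v)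
    (h1 : muckenhouptOne v < ∞) (h2 : muckenhouptTwo v < ∞) :
    ((∀ f : ℂ → ℂ, MemDirichlet v f → ∀ z ∈ unitDisc,
        IntervalIntegrable (generalizedHilbertIntegrand hilbertSymbol f z) volume 0 1) ∧
      IsBoundedOnDirichlet v hilbertOperator) ∧
    ((∀ f : ℂ → ℂ, MemDirichlet v f → ∀ z ∈ unitDisc,
        IntervalIntegrable (sublinearHilbertIntegrand f z) volume 0 1) ∧
      IsBoundedOnDirichlet v sublinearHilbertOperator) := by
  obtain ⟨C, hC⟩ := hv.exists_cauchy_bound h1 h2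
  have hmeas : ∀ f : ℂ → ℂ, MemDirichlet v f →
      AEStronglyMeasurable (fun t : ℝ ↦ f t) (volume.restrict (Ioo (0 : ℝ) 1)) := fun f hf ↦
    (hf.analytic.continuousOn.comp (by fun_prop) fun t ht ↦
      ofReal_mem_unitDisc (Ioo_subset_Ico_self ht)).aestronglyMeasurable measurableSet_Ioo
  have hlin := fun f hf ↦ hC f hf (fun t ↦ f t) (hmeas f hf) (fun _ _ ↦ rfl)
    (hilbertOperator f) fun z hz ↦ by
      refine intervalIntegral.integral_congr fun t ht ↦ ?_
      rw [uIcc_of_le zero_le_one] at ht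
      exact generalizedHilbertIntegrand_hilbertSymbol f hz ht
  have hsub := fun f hf ↦ hC f hf (fun t ↦ (‖f t‖ : ℂ))
    (Complex.continuous_ofReal.comp_aestronglyMeasurable (hmeas f hf).norm) (fun _ _ ↦ by simp)
    (sublinearHilbertOperator f) fun z hz ↦ rfl
  refine ⟨⟨fun f hf z hz ↦ ?_, C, fun f hf ↦ (hlin f hf).2⟩,
    ⟨fun f hf z hz ↦ intervalIntegrable_div_one_sub_mul (hsub f hf).1 hz,
      C, fun f hf ↦ (hsub f hf).2⟩⟩
  refine (intervalIntegrable_div_one_sub_mul (hlin f hf).1 hz).congr ?_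
  intro t ht
  rw [uIoc_of_le zero_le_one] at ht
  exact (generalizedHilbertIntegrand_hilbertSymbol f hz (Ioc_subset_Icc_self ht)).symm
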